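/- **Setting.** A *replicated data type* $\mathcal F$ assigns a value $\mathcal F(op,C)$ to every operation $op$ and every *operation context* $C=(E,\mathsf{op},\mathsf{vis},\mathsf{ar})$ ($E$ a finite set of events labelled with operations by $\mathsf{op}$, $\mathsf{vis}$ an acyclic relation and $\mathsf{ar}$ a strict total order on $E$), the same for isomorphic contexts. An operation $op$ is *read-only* if deleting from any context an event labelled $op$ never changes the value of any operation. An *ACT specification* is a pair $(\mathcal F,\mathsf{lvlmap})$, where $\mathsf{lvlmap}(op)\subseteq\{\mathsf{weak},\mathsf{strong}\}$ is the set of levels at which $op$ may be invoked. **Histories and guarantees.** A *history* is $H=(E,\mathsf{op},\mathsf{rval},\mathsf{rb},\mathsf{ss},\mathsf{lvl})$: a countable set $E$ of events (invocations) with their operations, their return values ($\nabla$ if the event is pending), the returns-before relation $\mathsf{rb}$ (a strict partial order, an interval order, in which every event has finitely many predecessors and a pending event has no successor), the same-session equivalence relation $\mathsf{ss}$ (on every session $\mathsf{rb}$ is a total order), and their levels. An *abstract execution* $A=(H,\mathsf{vis},\mathsf{ar},\mathsf{par})$ adds to a history an acyclic relation $\mathsf{vis}$ for which every $\mathsf{vis}^{-1}(e)$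 is finite, a strict total order $\mathsf{ar}$, and for each event $e$ a strict total order $\mathsf{par}(e)$. Put $\mathsf{context}(A,e)=(\mathsf{vis}^{-1}(e),\mathsf{op},\mathsf{vis},\mathsf{ar})$, $\mathsf{fcontext}(A,e)=(\mathsf{vis}^{-1}(e),\mathsf{op},\mathsf{vis},\mathsf{par}(e))$, $\mathsf{hb}=((\mathsf{rb}\cap\mathsf{ss})\cup\mathsf{vis})^+$, $\mathsf{rank}(S,\mathsf{rel},a)=|\{b\in S: b\xrightarrow{\mathsf{rel}}a\}|$, and, for a level $l$, $L=\{e\in E:\mathsf{lvl}(e)=l\}$. Define - $\mathrm{EV}(l)$: for every $e\in E$ the set $\{e'\in L: e\xrightarrow{\mathsf{rb}}e',\ e\not\xrightarrow{\mathsf{vis}}e'\}$ is finite; - $\mathrm{NCC}(l)$: $\mathsf{hb}\cap(L\times L)$ is acyclic; - $\mathrm{RVal}(l,\mathcal F)$: $\mathsf{rval}(e)=\mathcal F(\mathsf{op}(e),\mathsf{context}(A,e))$ for all $e\in L$; $\mathrm{FRVal}(l,\mathcal F)$: the same with $\mathsf{fcontext}$ in place of $\mathsf{context}$; - $\mathrm{CPar}(l)$: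 for every $e\in E$ the set of those $e'\in L$ with $e\xrightarrow{\mathsf{vis}}e'$ and $\mathsf{rank}(\mathsf{vis}^{-1}(e'),\mathsf{par}(e'),e)\ne\mathsf{rank}(\mathsf{vis}^{-1}(e'),\mathsf{ar},e)$ is finite; - $\mathrm{SinOrd}(l)$: there is a set $E'$ of pending events with $\mathsf{vis}\cap(E\times L)=(\mathsf{ar}\cap(E\times L))\setminus(E'\times E)$; - $\mathrm{RT}(l)$: $\mathsf{rb}\cap(L\times L)\subseteq\mathsf{ar}$; - $\mathrm{BEC}(l,\mathcal F)=\mathrm{EV}(l)\wedge\mathrm{NCC}(l)\wedge\mathrm{RVal}(l,\mathcal F)$; - $\mathrm{FEC}(l,\mathcal F)=\mathrm{EV}(l)\wedge\mathrm{NCC}(l)\wedge\mathrm{FRVal}(l,\mathcal F)\wedge\mathrm{CPar}(l)$; - $\mathrm{Lin}(l,\mathcal F)=\mathrm{SinOrd}(l)\wedge\mathrm{RT}(l)\wedge\mathrm{BEC}(l,\mathcal F)$. **The state object.** Requests are records $r=(\mathsf{timestamp},\mathsf{dot},\mathsf{ctx},\mathsf{lvl},op)$, where $\mathsf{dot}$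 is a pair (replica, event number) and $\mathsf{ctx}$ a set of such pairs. A list $\alpha$ of distinct requests determines $C_\alpha=(E_\alpha,\mathsf{op}_\alpha,\mathsf{vis}_\alpha,\mathsf{ar}_\alpha)$: $E_\alpha$ is the set of requests in $\alpha$, labelled with their operations; $\mathsf{ar}_\alpha$ is their order in $\alpha$; and $r\xrightarrow{\mathsf{vis}_\alpha}r'$ iff $r.\mathsf{dot}\in r'.\mathsf{ctx}$ when $r'$ is weak, and iff $r\xrightarrow{\mathsf{ar}_\alpha}r'$ when $r'$ is strong; call $\alpha$ a *trace* if $\mathsf{vis}_\alpha$ is acyclic. Every replica has a state object, a black box which is assumed to hold a state $S_\alpha$ determined by the current trace $\alpha$, i.e. by the list of the requests executed on it and not rolled back: initially the state is $S_{[\,]}$; executing $r$ in state $S_\alpha$ returns $\mathcal F(r.op,C_\alpha)$ and leads to $S_{\alpha\cdot r}$; rolling back $r$ in state $S_{\alpha\cdot r}$ leads to $S_\alpha$; and executing a plain read-only operation $op$ in $S_\alpha$ returns $\mathcal F(op,C_\alpha)$ and leaves the state $S_\alpha$ (for all $\alpha$, $r$ such that the lists involved are traces). **AcuteBayou.** Each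 of finitely many replicas $R_i$ keeps a state object, an event counter, a map of requests awaiting a response, and lists $\mathsf{committed}$, $\mathsf{tentative}$, $\mathsf{executed}$, $\mathsf{toBeExecuted}$, $\mathsf{toBeRolledBack}$ of requests, all initially empty (the counter is $0$). *Adjusting the execution* to a list $N$ means: let $P$ be the longest common prefix of $\mathsf{executed}$ and $N$; append the elements of $\mathsf{executed}$ outside $P$, in reverse order, to $\mathsf{toBeRolledBack}$; set $\mathsf{executed}:=P$ and let $\mathsf{toBeExecuted}$ be the list of the elements of $N$ outside $P$. The *insertion* of $r$ inserts $r$ into $\mathsf{tentative}$, which is sorted by $(\mathsf{timestamp},\mathsf{dot})$, and adjusts the execution to $\mathsf{committed}\cdot\mathsf{tentative}$. The atomic steps are: - *invocation* of a weak read-only operation: execute it on the state object and return the response; - *invocation* of any other operation $op$: increment the counter and form the request $r$ with the current local clock value, the dot ($i$, counter), $\mathsf{ctx}$ the set of dots of the requests in $\mathsf{executed}$ and $\mathsf{toBeRolledBack}$, the level, and $op$. If it is weak, execute $r$ on the state object and immediately roll it back, broadcast $r$ by reliable broadcast (RB) and by total-order broadcast (TOB), insert $r$, and return the response. If it is strong,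 record $r$ as awaiting a response (not yet known) and broadcast $r$ by TOB only; - *RB-delivery* of $r$: if $r$ was not issued by $R_i$ and $r\notin\mathsf{committed}$, insert $r$; - *TOB-delivery* of $r$: append $r$ to $\mathsf{committed}$, remove it from $\mathsf{tentative}$, adjust the execution to $\mathsf{committed}\cdot\mathsf{tentative}$; if $r$ awaits a response and $r\in\mathsf{executed}$, return the stored response and remove $r$ from the map; - *rollback*, enabled if $\mathsf{toBeRolledBack}\neq[\,]$: remove its head and roll it back on the state object; - *execution*, enabled if $\mathsf{toBeRolledBack}=[\,]\ne\mathsf{toBeExecuted}$: move the head $r$ of $\mathsf{toBeExecuted}$ to the end of $\mathsf{executed}$ and execute it on the state object; if $r$ awaits a response, return the response and remove $r$ from the map when $r$ is weak or $r\in\mathsf{committed}$, and store the response otherwise. **Stable runs.** A *stable run* is an infinite fair interleaving of steps of the replicas (no replica crashes, and no internal step, rollback or execution, stays enabled forever at a replica without being taken again), in which local clocks are monotone; every operation is invoked at a level allowed by $\mathsf{lvlmap}$; a client invokes an operation only after its previous one has returned; a message is RB- (TOB-) delivered only after it was RB- (TOB-) broadcast and at most once by each replica; every message that is RB- (TOB-)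 broadcast is eventually RB- (TOB-) delivered by every replica; and all replicas TOB-deliver messages in the same order. The *history of the run* consists of the invocations, with their operations, levels and sessions (clients), their return values, and $e\xrightarrow{\mathsf{rb}}e'$ iff $e$ returns at a step before the one in which $e'$ is invoked. **Theorem 3.** Let $(\mathcal F,\mathsf{lvlmap})$ be an arbitrary ACT specification and let AcuteBayou run with a state object that has the above properties with respect to $\mathcal F$. Then in stable runs AcuteBayou satisfies $\mathrm{FEC}(\mathsf{weak},\mathcal F)\wedge\mathrm{Lin}(\mathsf{strong},\mathcal F)$: the history $H$ of every stable run can be extended to an abstract execution $A=(H,\mathsf{vis},\mathsf{ar},\mathsf{par})$ which satisfies both $\mathrm{FEC}(\mathsf{weak},\mathcal F)$ and $\mathrm{Lin}(\mathsf{strong},\mathcal F)$. -/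

import Mathlib

universe u v w x

namespace ACT

/-! ### Binary relations -/

section Relations

variable {A : Type*}

/-- No cycle `x → ... → x`. -/
def Acyclic (rel : A → A → Prop) : Prop := ∀ a, ¬ Relation.TransGen rel a a

/-- Every element has finitely many predecessors. -/
def Natural (rel : A → A → Prop) : Prop := ∀ a, {b | rel b a}.Finite

/-- Irreflexive and transitive. -/
def PartialOrd (rel : A → A → Prop) : Prop :=
  (∀ a, ¬ rel a a) ∧ ∀ a b c, rel a b → rel b c → rel a c

/-- A (strict) partial order in which any two distinct elements are related. -/
def TotalOrd (rel : A → A → Prop) : Prop :=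
  PartialOrd rel ∧ ∀ a b, a ≠ b → rel a b ∨ rel b a

/-- A natural total order. -/
def Enumeration (rel : A → A → Prop) : Prop := TotalOrd rel ∧ Natural rel

/-- `rank S rel a = |{b ∈ S : b → a}|`. -/
noncomputable def rank (S : Set A) (rel : A → A → Prop) (a : A) : ℕ∞ :=
  {b | b ∈ S ∧ rel b a}.encard

theorem Acyclic.comap {B : Type*} {rel : A → A → Prop} (h : Acyclic rel) (f : B → A) :
    Acyclic (fun a b => rel (f a) (f b)) :=
  fun a ha => h (f a) (Relation.TransGen.lift f (fun _ _ hab => hab) _ _ ha)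

theorem TotalOrd.comap {B : Type*} {rel : A → A → Prop} (h : TotalOrd rel) {f : B → A}
    (hf : Function.Injective f) : TotalOrd (fun a b => rel (f a) (f b)) :=
  ⟨⟨fun a => h.1.1 (f a), fun a b c => h.1.2 (f a) (f b) (f c)⟩,
    fun _ _ hab => h.2 _ _ (fun e => hab (hf e))⟩

end Relations

/-! ### Replicated data types and ACT specifications -/

/-- Consistency levels. -/
inductive Level where
  | weak
  | strong

/-- An operation context `(E, op, vis, ar)`: the event graph of the operations visible to an
operation. -/
structure OpContext (Op : Type u) where
  E : Type
  finite : Finite E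
  op : E → Op
  vis : E → E → Prop
  ar : E → E → Prop
  vis_acyclic : Acyclic vis
  ar_total : TotalOrd ar

/-- Isomorphism of operation contexts. -/
def OpContext.Iso {Op : Type u} (C D : OpContext Op) : Prop :=
  ∃ φ : C.E ≃ D.E, (∀ a, C.op a = D.op (φ a)) ∧
    (∀ a b, C.vis a b ↔ D.vis (φ a) (φ b)) ∧ (∀ a b, C.ar a b ↔ D.ar (φ a) (φ b))

/-- The context `(E \ {e}, op, vis, ar)`. -/
def OpContext.erase {Op : Type u} (C : OpContext Op) (e : C.E) : OpContext Op where
  E := {a : C.E // a ≠ e}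
  finite := haveI := C.finite; inferInstance
  op a := C.op a
  vis a b := C.vis a b
  ar a b := C.ar a b
  vis_acyclic := C.vis_acyclic.comap _
  ar_total := C.ar_total.comap Subtype.val_injective

/-- A replicated data type: the return value of every operation in every context, the same for
isomorphic contexts. The type `Op` is the set of its operations. -/
structure ReplicatedDataType (Op : Type u) (Val : Type v) where
  F : Op → OpContext Op → Val
  iso_invariant : ∀ o C D, OpContext.Iso C D → F o C = F o D

/-- The read-only operations: those whose events can be removed from any context without
changing the result of any operation. -/
def ReplicatedDataType.readonlyops {Op : Type u} {Val : Type v}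
    (D : ReplicatedDataType Op Val) : Set Op :=
  {o | ∀ (o₂ : Op) (C : OpContext Op) (e : C.E), C.op e = o → D.F o₂ C = D.F o₂ (C.erase e)}

/-- An ACT specification `(F, lvlmap)`. -/
structure Spec (Op : Type u) (Val : Type v) where
  rdt : ReplicatedDataType Op Val
  lvlmap : Op → Set Level

/-! ### Histories and abstract executions -/

/-- The event graph `(E, op, rval, rb, ss, lvl)`; `rval e = none` means that `e` is pending. -/
structure History (Op : Type u) (Val : Type v) where
  E : Type
  op : E → Op
  rval : E → Option Val
  rb : E → E → Prop
  ss : E → E → Prop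
  lvl : E → Level

/-- The conditions which make such an event graph a (well-formed) history. -/
structure History.WellFormed {Op : Type u} {Val : Type v} (H : History Op Val) : Prop where
  countable : Countable H.E
  rb_order : PartialOrd H.rb
  rb_natural : Natural H.rb
  ss_equiv : Equivalence H.ss
  pending : ∀ a b, H.rb a b → H.rval a ≠ none
  interval : ∀ a b c d, H.rb a b → H.rb c d → H.rb a d ∨ H.rb c b
  session : ∀ e, Enumeration (fun a b : {a : H.E // H.ss e a} => H.rb a b)

/-- An abstract execution `(H, vis, ar, par)` extending the history `H`. -/
structure AbstractExecution {Op : Type u} {Val : Type v} (H : History Op Val) where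
  wellFormed : H.WellFormed
  vis : H.E → H.E → Prop
  ar : H.E → H.E → Prop
  par : H.E → H.E → H.E → Prop
  vis_acyclic : Acyclic vis
  vis_natural : Natural vis
  ar_total : TotalOrd ar
  par_total : ∀ e, TotalOrd (par e)

namespace AbstractExecution

variable {Op : Type u} {Val : Type v} {H : History Op Val} (A : AbstractExecution H)

/-- `(vis⁻¹(e), op, vis, ar)`. -/
def context (e : H.E) : OpContext Op where
  E := {a : H.E // A.vis a e}
  finite := (A.vis_natural e).to_subtype
  op a := H.op a
  vis a b := A.vis a b
  ar a b := A.ar a b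
  vis_acyclic := A.vis_acyclic.comap _
  ar_total := A.ar_total.comap Subtype.val_injective

/-- `(vis⁻¹(e), op, vis, par(e))`. -/
def fcontext (e : H.E) : OpContext Op where
  E := {a : H.E // A.vis a e}
  finite := (A.vis_natural e).to_subtype
  op a := H.op a
  vis a b := A.vis a b
  ar a b := A.par e a b
  vis_acyclic := A.vis_acyclic.comap _
  ar_total := (A.par_total e).comap Subtype.val_injective

/-- Session order: `rb ∩ ss`. -/
def so (_A : AbstractExecution H) (a b : H.E) : Prop := H.rb a b ∧ H.ss a b

/-- Happens-before: `(so ∪ vis)⁺`. -/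
def hb : H.E → H.E → Prop := Relation.TransGen (fun a b => A.so a b ∨ A.vis a b)

/-- Eventual visibility. -/
def EV (l : Level) : Prop :=
  ∀ e, {e₂ | H.lvl e₂ = l ∧ H.rb e e₂ ∧ ¬ A.vis e e₂}.Finite

/-- No circular causality. -/
def NCC (l : Level) : Prop :=
  Acyclic (fun a b => A.hb a b ∧ H.lvl a = l ∧ H.lvl b = l)

/-- Return value consistency. -/
def RVal (l : Level) (D : ReplicatedDataType Op Val) : Prop :=
  ∀ e, H.lvl e = l → H.rval e = some (D.F (H.op e) (A.context e))

/-- Return value consistency with respect to perceived arbitration. -/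
def FRVal (l : Level) (D : ReplicatedDataType Op Val) : Prop :=
  ∀ e, H.lvl e = l → H.rval e = some (D.F (H.op e) (A.fcontext e))

/-- Convergent perceived arbitration. -/
def CPar (l : Level) : Prop :=
  ∀ e, {e₂ | H.lvl e₂ = l ∧ A.vis e e₂ ∧
    rank {a | A.vis a e₂} (A.par e₂) e ≠ rank {a | A.vis a e₂} A.ar e}.Finite

/-- Basic eventual consistency. -/
def BEC (l : Level) (D : ReplicatedDataType Op Val) : Prop :=
  A.EV l ∧ A.NCC l ∧ A.RVal l D

/-- Fluctuating eventual consistency. -/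
def FEC (l : Level) (D : ReplicatedDataType Op Val) : Prop :=
  A.EV l ∧ A.NCC l ∧ A.FRVal l D ∧ A.CPar l

/-- Single order: on `E × L` one has `vis = ar \ (P × E)` for a set `P` of pending events. -/
def SinOrd (l : Level) : Prop :=
  ∃ P : Set H.E, (∀ e ∈ P, H.rval e = none) ∧
    ∀ a b, H.lvl b = l → (A.vis a b ↔ A.ar a b ∧ a ∉ P)

/-- Real-time order. -/
def RT (l : Level) : Prop :=
  ∀ a b, H.lvl a = l → H.lvl b = l → H.rb a b → A.ar a b

/-- Linearizability. -/
def Lin (l : Level) (D : ReplicatedDataType Op Val) : Prop :=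
  A.SinOrd l ∧ A.RT l ∧ A.BEC l D

end AbstractExecution

/-- The history `H` is correct according to the guarantee `P`. -/
def History.Satisfies {Op : Type u} {Val : Type v} (H : History Op Val)
    (P : AbstractExecution H → Prop) : Prop :=
  ∃ A : AbstractExecution H, P A

/-! ### Requests and the state object -/

/-- The request record; `lvl` is the flag telling strong operations from weak ones. -/
structure Req (n : ℕ) (Op : Type u) where
  timestamp : ℤ
  dot : Fin n × ℕ
  ctx : Set (Fin n × ℕ)
  lvl : Level
  op : Op

/-- The order of requests: lexicographic by timestamp, replica, event number. -/
def Req.lt {n : ℕ} {Op : Type u} (r s : Req n Op) : Prop :=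
  r.timestamp < s.timestamp ∨ (r.timestamp = s.timestamp ∧
    (r.dot.1 < s.dot.1 ∨ (r.dot.1 = s.dot.1 ∧ r.dot.2 < s.dot.2)))

/-- The visibility between the requests (identified by their positions) of a trace: by the `ctx`
field for weak requests, by the order in the trace for strong ones. -/
def traceVis {n : ℕ} {Op : Type u} (α : List (Req n Op)) (i j : Fin α.length) : Prop :=
  match (α.get j).lvl with
  | Level.weak => (α.get i).dot ∈ (α.get j).ctx
  | Level.strong => i < j

/-- The traces to which the requirements on the state object apply: lists of distinct requests
whose visibility relation is acyclic, so that they determine an operation context. -/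
def ValidTrace {n : ℕ} {Op : Type u} (α : List (Req n Op)) : Prop :=
  α.Nodup ∧ Acyclic (traceVis α)

/-- The context determined by a trace. -/
def traceContext {n : ℕ} {Op : Type u} (α : List (Req n Op)) (hα : ValidTrace α) :
    OpContext Op where
  E := Fin α.length
  finite := inferInstance
  op i := (α.get i).op
  vis := traceVis α
  ar i j := i < j
  vis_acyclic := hα.2
  ar_total := ⟨⟨fun a => lt_irrefl a, fun _ _ _ => lt_trans⟩, fun _ _ h => lt_or_gt_of_ne h⟩

/-- The interface of the object which executes the operations at a replica. The function
`executeOp` is the variant of `execute` which takes a plain read-only operation. -/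
structure StateObject (n : ℕ) (Op : Type u) (Val : Type v) where
  State : Type w
  init : State
  execute : State → Req n Op → State × Val
  executeOp : State → Op → State × Val
  rollback : State → Req n Op → State

/-- The requirements on the state object: its state is a function `S` of the current trace (the
requests executed and not rolled back), and responses are those which the data type prescribes
in the context determined by the trace. -/
def StateObject.Implements {n : ℕ} {Op : Type u} {Val : Type v}
    (O : StateObject.{u, v, w} n Op Val) (D : ReplicatedDataType Op Val) : Prop :=
  ∃ S : List (Req n Op) → O.State,
    S [] = O.init ∧
    (∀ α (hα : ValidTrace α) r, ValidTrace (α ++ [r]) →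
      O.execute (S α) r = (S (α ++ [r]), D.F r.op (traceContext α hα))) ∧
    (∀ α r, ValidTrace (α ++ [r]) → O.rollback (S (α ++ [r])) r = S α) ∧
    (∀ α (hα : ValidTrace α), ∀ o ∈ D.readonlyops,
      O.executeOp (S α) o = (S α, D.F o (traceContext α hα)))

/-! ### The AcuteBayou protocol -/

/-- The local variables of a replica. In the map `awaiting` of requests awaiting a response,
`none` means that the request is not in the map, `some none` that its response is not yet known. -/
structure ReplicaState (n : ℕ) (Op : Type u) (Val : Type v) (State : Type w) where
  state : State
  currEventNo : ℕ
  committed : List (Req n Op)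
  tentative : List (Req n Op)
  executed : List (Req n Op)
  toBeExecuted : List (Req n Op)
  toBeRolledBack : List (Req n Op)
  awaiting : Req n Op → Option (Option Val)

/-- The steps of a replica: invocation of an operation (in a session `c`, at a level), delivery
of a message by reliable or by total-order broadcast, and the two internal steps. -/
inductive Event (n : ℕ) (Op : Type u) (Client : Type x) where
  | invoke (c : Client) (o : Op) (l : Level)
  | rbDeliver (r : Req n Op)
  | tobDeliver (r : Req n Op)
  | rollback
  | execute

/-- A response returned to a client: to the client invoking an operation in the very step, or to
the one which awaits the response to a request. -/
inductive Reply (n : ℕ) (Op : Type u) (Val : Type v) where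
  | immediate (v : Val)
  | deferred (r : Req n Op) (v : Val)

/-- The effects of a step: the new local state, the messages broadcast and the response. -/
structure Outcome (n : ℕ) (Op : Type u) (Val : Type v) (State : Type w) where
  next : ReplicaState n Op Val State
  rbCast : Option (Req n Op) := none
  tobCast : Option (Req n Op) := none
  reply : Option (Reply n Op Val) := none

section Protocol

variable {n : ℕ} {Op : Type u} {Val : Type v}

open Classical in
/-- The longest common prefix of two lists. -/
noncomputable def longestCommonPrefix {A : Type*} : List A → List A → List A
  | a :: as, b :: bs => if a = b then a :: longestCommonPrefix as bs else []
  | _, _ => []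

open Classical in
noncomputable def adjustExecution {State : Type w} (σ : ReplicaState n Op Val State)
    (newOrder : List (Req n Op)) : ReplicaState n Op Val State :=
  let inOrder := longestCommonPrefix σ.executed newOrder
  let outOfOrder := σ.executed.filter (fun y => y ∉ inOrder)
  { σ with
    executed := inOrder
    toBeExecuted := newOrder.filter (fun y => y ∉ inOrder)
    toBeRolledBack := σ.toBeRolledBack ++ outOfOrder.reverse }

open Classical in
noncomputable def insertIntoTentative {State : Type w} (σ : ReplicaState n Op Val State)
    (r : Req n Op) : ReplicaState n Op Val State :=
  let previous := σ.tentative.filter (fun y => y.lt r)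
  let subsequent := σ.tentative.filter (fun y => r.lt y)
  let tentative := previous ++ [r] ++ subsequent
  adjustExecution { σ with tentative := tentative } (σ.committed ++ tentative)

open Classical in
/-- The commit procedure, run when `r` is delivered by total-order broadcast. -/
noncomputable def commit {State : Type w} (σ : ReplicaState n Op Val State)
    (r : Req n Op) : Outcome n Op Val State :=
  let committed := σ.committed ++ [r]
  let tentative := σ.tentative.filter (fun y => y ≠ r)
  let τ := adjustExecution { σ with committed := committed, tentative := tentative }
    (committed ++ tentative)
  if r ∈ τ.executed then
    match τ.awaiting r with
    | some (some v) =>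
        { next := { τ with awaiting := Function.update τ.awaiting r none }
          reply := some (Reply.deferred r v) }
    | _ => { next := τ }
  else { next := τ }

/-- The initial local state. -/
def initialState (O : StateObject.{u, v, w} n Op Val) : ReplicaState n Op Val O.State where
  state := O.init
  currEventNo := 0
  committed := []
  tentative := []
  executed := []
  toBeExecuted := []
  toBeRolledBack := []
  awaiting := fun _ => none

open Classical in
/-- Invocation of an operation at replica `i`, when its local clock shows `time`. -/
noncomputable def invokeStep (D : ReplicatedDataType Op Val) (O : StateObject.{u, v, w} n Op Val)
    (i : Fin n) (time : ℤ) (o : Op) (l : Level) (σ : ReplicaState n Op Val O.State) :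
    Outcome n Op Val O.State :=
  let request : Req n Op :=
    { timestamp := time
      dot := (i, σ.currEventNo + 1)
      ctx := {d | ∃ s, (s ∈ σ.executed ∨ s ∈ σ.toBeRolledBack) ∧ s.dot = d}
      lvl := l
      op := o }
  match l with
  | Level.weak =>
      if o ∈ D.readonlyops then
        let res := O.executeOp σ.state o
        { next := { σ with state := res.1 }
          reply := some (Reply.immediate res.2) }
      else
        let res := O.execute σ.state request
        { next := insertIntoTentative
            { σ with
              currEventNo := σ.currEventNo + 1
              state := O.rollback res.1 request } request
          rbCast := some request
          tobCast := some request
          reply := some (Reply.immediate res.2) }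
  | Level.strong =>
      { next :=
          { σ with
            currEventNo := σ.currEventNo + 1
            awaiting := Function.update σ.awaiting request (some none) }
        tobCast := some request }

open Classical in
/-- Delivery of `r` at replica `i` by reliable broadcast. -/
noncomputable def rbDeliverStep {State : Type w} (i : Fin n) (r : Req n Op)
    (σ : ReplicaState n Op Val State) : Outcome n Op Val State :=
  if r.dot.1 = i ∨ r ∈ σ.committed then { next := σ } else { next := insertIntoTentative σ r }

/-- Rollback of the first request scheduled for rollback. -/
def rollbackStep (O : StateObject.{u, v, w} n Op Val) (σ : ReplicaState n Op Val O.State) :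
    Outcome n Op Val O.State :=
  match σ.toBeRolledBack with
  | [] => { next := σ }
  | head :: tail =>
      { next := { σ with state := O.rollback σ.state head, toBeRolledBack := tail } }

open Classical in
/-- Execution of the first request scheduled for execution. -/
noncomputable def executeStep (O : StateObject.{u, v, w} n Op Val)
    (σ : ReplicaState n Op Val O.State) : Outcome n Op Val O.State :=
  match σ.toBeExecuted with
  | [] => { next := σ }
  | head :: tail =>
      let res := O.execute σ.state head
      let τ : ReplicaState n Op Val O.State :=
        { σ with
          state := res.1
          executed := σ.executed ++ [head]
          toBeExecuted := tail }
      if σ.awaiting head = none then { next := τ }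
      else if head.lvl = Level.weak ∨ head ∈ σ.committed then
        { next := { τ with awaiting := Function.update σ.awaiting head none }
          reply := some (Reply.deferred head res.2) }
      else
        { next := { τ with awaiting := Function.update σ.awaiting head (some (some res.2)) } }

/-- The atomic step of replica `i` for a given event. -/
noncomputable def step {Client : Type x} (D : ReplicatedDataType Op Val)
    (O : StateObject.{u, v, w} n Op Val) (i : Fin n) (time : ℤ)
    (σ : ReplicaState n Op Val O.State) : Event n Op Client → Outcome n Op Val O.State
  | Event.invoke _ o l => invokeStep D O i time o l σ
  | Event.rbDeliver r => rbDeliverStep i r σ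
  | Event.tobDeliver r => commit σ r
  | Event.rollback => rollbackStep O σ
  | Event.execute => executeStep O σ

end Protocol

/-! ### Runs -/

/-- An infinite interleaving of events of `n` replicas, with the reading of the local clock at
each event. At an instant `t` with `event t = none` no replica takes a step, so that executions in
which nothing happens from some moment on are included. -/
structure Run (n : ℕ) (Op : Type u) (Client : Type x) where
  event : ℕ → Option (Fin n × Event n Op Client)
  clock : ℕ → ℤ

namespace Run

variable {n : ℕ} {Op : Type u} {Val : Type v} {Client : Type x} (ρ : Run n Op Client)
  (D : ReplicatedDataType Op Val) (O : StateObject.{u, v, w} n Op Val)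

/-- The local states of all replicas just before instant `t`. -/
noncomputable def config : ℕ → Fin n → ReplicaState n Op Val O.State
  | 0 => fun _ => initialState O
  | t + 1 =>
      match ρ.event t with
      | none => config t
      | some (i, ev) =>
          Function.update (config t) i (step D O i (ρ.clock t) (config t i) ev).next

/-- The effects of the step taken at instant `t`. -/
noncomputable def outcome (t : ℕ) : Option (Outcome n Op Val O.State) :=
  (ρ.event t).map (fun p => step D O p.1 (ρ.clock t) (ρ.config D O t p.1) p.2)

/-- At instant `t` the request `r` is broadcast by reliable broadcast. -/
def RBCast (t : ℕ) (r : Req n Op) : Prop := ∃ q, ρ.outcome D O t = some q ∧ q.rbCast = some r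

/-- At instant `t` the request `r` is broadcast by total-order broadcast. -/
def TOBCast (t : ℕ) (r : Req n Op) : Prop := ∃ q, ρ.outcome D O t = some q ∧ q.tobCast = some r

/-- At instant `t` the replica `i` delivers `r` by reliable broadcast. -/
def RBDelivers (i : Fin n) (t : ℕ) (r : Req n Op) : Prop :=
  ρ.event t = some (i, Event.rbDeliver r)

/-- At instant `t` the replica `i` delivers `r` by total-order broadcast. -/
def TOBDelivers (i : Fin n) (t : ℕ) (r : Req n Op) : Prop :=
  ρ.event t = some (i, Event.tobDeliver r)

/-- The session, operation and level of the invocation at instant `t`, if there is one. -/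
def invocation (t : ℕ) : Option (Client × Op × Level) :=
  match ρ.event t with
  | some (_, Event.invoke c o l) => some (c, o, l)
  | _ => none

/-- The operation invoked at instant `t` is answered by `v` at instant `k`. -/
def Answered (t k : ℕ) (v : Val) : Prop :=
  (∃ q, ρ.outcome D O t = some q ∧ q.reply = some (Reply.immediate v) ∧ k = t) ∨
  (∃ r q, ρ.TOBCast D O t r ∧ t < k ∧ ρ.outcome D O k = some q ∧
    q.reply = some (Reply.deferred r v))

open Classical in
/-- The history of a run: its events are the invocations (represented by their instants), the
return value of an event is the first answer, and `a` returns before `b` if `a` is answered at an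
instant before the invocation of `b`. -/
noncomputable def history : History Op Val where
  E := {t : ℕ // (ρ.invocation t).isSome}
  op e := ((ρ.invocation e).get e.2).2.1
  rval e :=
    if h : ∃ k v, ρ.Answered D O e k v then some (Nat.find_spec h).choose else none
  rb a b := ∃ k v, ρ.Answered D O a k v ∧ k < b
  ss a b := ((ρ.invocation a).get a.2).1 = ((ρ.invocation b).get b.2).1
  lvl e := ((ρ.invocation e).get e.2).2.2

/-- The run is an execution of the protocol: internal steps are taken only when enabled, local
clocks are monotone, clients respect `lvlmap`, and a client invokes an operation only after its
previous operations have returned. -/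
structure IsExecution (lvlmap : Op → Set Level) : Prop where
  rollback_enabled : ∀ t i, ρ.event t = some (i, Event.rollback) →
    (ρ.config D O t i).toBeRolledBack ≠ []
  execute_enabled : ∀ t i, ρ.event t = some (i, Event.execute) →
    (ρ.config D O t i).toBeRolledBack = [] ∧ (ρ.config D O t i).toBeExecuted ≠ []
  clock_mono : ∀ s t i ev₁ ev₂, s ≤ t → ρ.event s = some (i, ev₁) →
    ρ.event t = some (i, ev₂) → ρ.clock s ≤ ρ.clock t
  levels : ∀ t c o l, ρ.invocation t = some (c, o, l) → l ∈ lvlmap o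
  sequential : ∀ s t c p₁ p₂, s < t → ρ.invocation s = some (c, p₁) →
    ρ.invocation t = some (c, p₂) → ∃ k v, ρ.Answered D O s k v ∧ k < t

/-- Fairness: at no replica does an internal step stay enabled forever from some moment on
without being taken again. -/
structure Fair : Prop where
  rollback : ∀ i N, ∃ t, N ≤ t ∧
    (ρ.event t = some (i, Event.rollback) ∨ (ρ.config D O t i).toBeRolledBack = [])
  execute : ∀ i N, ∃ t, N ≤ t ∧
    (ρ.event t = some (i, Event.execute) ∨
      ¬ ((ρ.config D O t i).toBeRolledBack = [] ∧ (ρ.config D O t i).toBeExecuted ≠ []))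

/-- Reliable broadcast among replicas none of which crashes. -/
structure ReliableBroadcast : Prop where
  integrity : ∀ i t r, ρ.RBDelivers i t r → ∃ s, s < t ∧ ρ.RBCast D O s r
  no_duplication : ∀ i s t r, ρ.RBDelivers i s r → ρ.RBDelivers i t r → s = t
  delivery : ∀ s r, ρ.RBCast D O s r → ∀ i, ∃ t, ρ.RBDelivers i t r

/-- Total-order broadcast among replicas none of which crashes, including the guarantee of
progress which holds in stable runs only. -/
structure StableTotalOrderBroadcast : Prop where
  integrity : ∀ i t r, ρ.TOBDelivers i t r → ∃ s, s < t ∧ ρ.TOBCast D O s r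
  no_duplication : ∀ i s t r, ρ.TOBDelivers i s r → ρ.TOBDelivers i t r → s = t
  total_order : ∀ i j s₁ t₁ s₂ t₂ r₁ r₂,
    ρ.TOBDelivers i s₁ r₁ → ρ.TOBDelivers i t₁ r₂ →
    ρ.TOBDelivers j s₂ r₁ → ρ.TOBDelivers j t₂ r₂ → s₁ < t₁ → s₂ < t₂
  delivery : ∀ s r, ρ.TOBCast D O s r → ∀ i, ∃ t, ρ.TOBDelivers i t r

/-- The stable runs of AcuteBayou. -/
structure IsStable (lvlmap : Op → Set Level) : Prop where
  execution : ρ.IsExecution D O lvlmap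
  fair : ρ.Fair D O
  rb : ρ.ReliableBroadcast D O
  tob : ρ.StableTotalOrderBroadcast D O

end Run

end ACT

/-!
In a stable run every request is eventually delivered by total-order broadcast, and the instants
`firstDelivery` at which requests are delivered for the first time anywhere enumerate the common
delivery order. They give the arbitration of the abstract execution: an operation with a request is
arbitrated at the first delivery of its request, a weak read-only operation at the instant of its
invocation. A strong operation sees everything arbitrated before it; a weak one sees the requests
in the trace of its replica (those executed and not rolled back) and all earlier weak read-only
operations. No operation is pending, so this is a single order for the strong operations.

Causality is acyclic since a natural number grows along `rb` and along visibility, namely `effect`: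
the instant of the invocation for weak operations, that of the first delivery for strong ones
(`effect_lt_of_rb`, `effect_lt_of_sees`). For the same reason every trace has an acyclic visibility
relation (`validTrace`), so that the assumptions on the state object apply all along the run and
its state is the one determined by the trace (`state_eq`). This rests on the invariants `Run.inv`
of the local lists. In particular a strong request is executed only after it has been committed,
hence after exactly the requests which precede it in the commit order (`answered_strong`).

Liveness comes from fairness (`eventually_prefix_executed`): as long as a committed prefix is not
executed, nothing is scheduled for rollback, so that the missing executions and pending rollbacks
run out. Therefore all traces eventually begin with any given part of the commit order, and a weak
operation which perceives requests in the order of its trace agrees with the arbitration on the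
rank of a fixed event, with finitely many exceptions (`abstractExecution_CPar`). Return values in
the abstract execution and in the traces agree since the contexts differ only by read-only events
(`ReplicatedDataType.F_eq_of_embedding`).
-/

namespace ACT

/-! ### Lists -/

section Lists

variable {A : Type*}

theorem longestCommonPrefix_prefix_left (l m : List A) : longestCommonPrefix l m <+: l := by
  fun_induction longestCommonPrefix l m with
  | case1 _ _ _ ih => exact (List.prefix_cons_inj _).2 ih
  | case2 => exact List.nil_prefix
  | case3 => exact List.nil_prefix

theorem longestCommonPrefix_prefix_right (l m : List A) : longestCommonPrefix l m <+: m := by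
  fun_induction longestCommonPrefix l m with
  | case1 _ _ _ ih => exact (List.prefix_cons_inj _).2 ih
  | case2 => exact List.nil_prefix
  | case3 => exact List.nil_prefix

theorem prefix_longestCommonPrefix {c l m : List A} (hl : c <+: l) (hm : c <+: m) :
    c <+: longestCommonPrefix l m := by
  induction c generalizing l m with
  | nil => exact List.nil_prefix
  | cons a c ih =>
    obtain ⟨l', rfl⟩ := hl
    obtain ⟨m', rfl⟩ := hm
    simpa [longestCommonPrefix] using ih (List.prefix_append c l') (List.prefix_append c m')

theorem filter_notMem_prefix {p l : List A} (h : p <+: l) (hl : l.Nodup)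
    (q : A → Bool) (hq : ∀ a, q a = true ↔ a ∉ p) : p ++ l.filter q = l := by
  obtain ⟨s, rfl⟩ := h
  rw [List.nodup_append] at hl
  have h1 : p.filter q = [] := List.filter_eq_nil_iff.2 (by simp [hq])
  have h2 : s.filter q = s :=
    List.filter_eq_self.2 fun a ha => (hq a).2 fun hp => hl.2.2 a hp a ha rfl
  rw [List.filter_append, h1, h2, List.nil_append]

end Lists

/-! ### Local states -/

section LocalState

variable {n : ℕ} {Op : Type u} {Val : Type v} {State : Type w}

/-- The requests executed on the state object and not rolled back yet, in the order of their
execution. The requests scheduled for rollback come last, the next one to be rolled back at the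
very end. -/
def ReplicaState.trace (σ : ReplicaState n Op Val State) : List (Req n Op) :=
  σ.executed ++ σ.toBeRolledBack.reverse

/-- The order in which the replica currently intends to execute the requests it knows. -/
def ReplicaState.order (σ : ReplicaState n Op Val State) : List (Req n Op) :=
  σ.committed ++ σ.tentative

variable (σ : ReplicaState n Op Val State) (N : List (Req n Op))

theorem executed_append_toBeExecuted_adjustExecution (hN : N.Nodup) :
    (adjustExecution σ N).executed ++ (adjustExecution σ N).toBeExecuted = N :=
  filter_notMem_prefix (longestCommonPrefix_prefix_right _ _) hN _ (by simp)

/-- Adjusting the execution only schedules rollbacks: nothing happens to the state object. -/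
theorem trace_adjustExecution (h : σ.executed.Nodup) :
    (adjustExecution σ N).trace = σ.trace := by
  have := filter_notMem_prefix (longestCommonPrefix_prefix_left σ.executed N) h
    (fun y => by classical exact decide (y ∉ longestCommonPrefix σ.executed N)) (by simp)
  simp only [ReplicaState.trace, adjustExecution, List.reverse_append, List.reverse_reverse]
  rw [← List.append_assoc]
  congr 1

theorem Req.lt_irrefl (r : Req n Op) : ¬ r.lt r := by
  simp [Req.lt]

theorem Req.lt_asymm {r s : Req n Op} (h : r.lt s) : ¬ s.lt r := by
  unfold Req.lt at *; omega

open Classical in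
/-- The list `tentative` after the insertion of `r`. -/
noncomputable def insertedTentative (l : List (Req n Op)) (r : Req n Op) : List (Req n Op) :=
  l.filter (fun y => y.lt r) ++ [r] ++ l.filter (fun y => r.lt y)

theorem insertIntoTentative_eq (r : Req n Op) :
    insertIntoTentative σ r =
      adjustExecution { σ with tentative := insertedTentative σ.tentative r }
        (σ.committed ++ insertedTentative σ.tentative r) := rfl

theorem mem_insertedTentative {l : List (Req n Op)} {r y : Req n Op}
    (h : y ∈ insertedTentative l r) : y = r ∨ y ∈ l := by
  simp only [insertedTentative, List.mem_append, List.mem_filter, List.mem_singleton] at h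
  tauto

theorem nodup_insertedTentative {l : List (Req n Op)} (r : Req n Op) (h : l.Nodup) :
    (insertedTentative l r).Nodup := by
  have := r.lt_irrefl
  simp only [insertedTentative, List.append_assoc, List.singleton_append]
  refine List.nodup_append.2 ⟨h.filter _, List.nodup_cons.2 ⟨by simp [this], h.filter _⟩, ?_⟩
  simp only [List.mem_filter, List.mem_cons, decide_eq_true_eq]
  rintro a ⟨-, ha⟩ b (rfl | ⟨-, hb⟩) rfl
  · exact this ha
  · exact Req.lt_asymm ha hb

/-- The facts about a local state which do not depend on the state object, relative to a set `K`
of known requests and to a numbering `δ` of the requests which the order of `committed` respects.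
By `trace_sorted` the trace respects `δ` around strong requests; this makes its visibility
relation acyclic. By `awaiting_eq` no response is ever stored: a strong request is executed
only after it has been committed. -/
structure ReplicaState.Inv (δ : Req n Op → ℕ) (K : Req n Op → Prop)
    (σ : ReplicaState n Op Val State) : Prop where
  order_nodup : σ.order.Nodup
  executed_append : σ.executed ++ σ.toBeExecuted = σ.order
  committed_sorted : σ.committed.Pairwise (fun x y => δ x < δ y)
  committed_lt : ∀ x ∈ σ.committed, ∀ y ∈ σ.tentative, δ x < δ y
  tentative_weak : ∀ r ∈ σ.tentative, r.lvl = Level.weak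
  order_known : ∀ r ∈ σ.order, K r
  trace_nodup : σ.trace.Nodup
  trace_known : ∀ r ∈ σ.trace, K r
  trace_strong : ∀ r ∈ σ.trace, r.lvl = Level.strong → r ∈ σ.committed
  trace_sorted : σ.trace.Pairwise
    (fun x y => x.lvl = Level.strong ∨ y.lvl = Level.strong → δ x < δ y)
  awaiting_eq : ∀ r, σ.awaiting r ≠ none → σ.awaiting r = some none
  awaiting_strong : ∀ r, σ.awaiting r ≠ none → r.lvl = Level.strong
  awaiting_executed : ∀ r, σ.awaiting r ≠ none → r ∉ σ.executed

namespace ReplicaState.Inv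

variable {σ} {δ : Req n Op → ℕ} {K : Req n Op → Prop}

theorem mono (h : σ.Inv δ K) {K' : Req n Op → Prop} (hK : ∀ r, K r → K' r) : σ.Inv δ K' :=
  { h with
    order_known := fun r hr => hK r (h.order_known r hr)
    trace_known := fun r hr => hK r (h.trace_known r hr) }

theorem executed_prefix (h : σ.Inv δ K) : σ.executed <+: σ.order :=
  ⟨_, h.executed_append⟩

theorem executed_nodup (h : σ.Inv δ K) : σ.executed.Nodup :=
  h.order_nodup.sublist h.executed_prefix.sublist

theorem order_strong (h : σ.Inv δ K) {r : Req n Op} (hr : r ∈ σ.order)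
    (hs : r.lvl = Level.strong) : r ∈ σ.committed := by
  rcases List.mem_append.1 hr with hr | hr
  · exact hr
  · exact absurd (h.tentative_weak r hr) (by simp [hs])

theorem order_sorted (h : σ.Inv δ K) :
    σ.order.Pairwise
      (fun x y => x.lvl = Level.strong ∨ y.lvl = Level.strong → δ x < δ y) := by
  refine List.pairwise_append.2 ⟨List.Pairwise.imp ?_ h.committed_sorted, ?_, ?_⟩
  · exact fun hxy _ => hxy
  · exact List.pairwise_of_forall_mem_list fun x hx y hy hs =>
      absurd hs (by simp [h.tentative_weak y hy, h.tentative_weak x hx])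
  · exact fun x hx y hy _ => h.committed_lt x hx y hy

theorem setState (h : σ.Inv δ K) (s : State) (c : ℕ) :
    ({ σ with state := s, currEventNo := c } : ReplicaState n Op Val State).Inv δ K :=
  { h with }

theorem adjust (h : σ.Inv δ K) {c l : List (Req n Op)} (hc : σ.committed <+: c)
    (hnd : (c ++ l).Nodup) (hs : c.Pairwise (fun x y => δ x < δ y))
    (hcl : ∀ x ∈ c, ∀ y ∈ l, δ x < δ y) (hl : ∀ r ∈ l, r.lvl = Level.weak)
    (hK : ∀ r ∈ c ++ l, K r) :
    (adjustExecution { σ with committed := c, tentative := l } (c ++ l)).Inv δ K := by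
  have ht := trace_adjustExecution { σ with committed := c, tentative := l } (c ++ l)
    h.executed_nodup
  have ht' : ({ σ with committed := c, tentative := l } : ReplicaState n Op Val State).trace
    = σ.trace := rfl
  rw [ht'] at ht
  constructor
  · exact hnd
  · exact executed_append_toBeExecuted_adjustExecution _ _ hnd
  · exact hs
  · exact hcl
  · exact hl
  · exact hK
  · rw [ht]; exact h.trace_nodup
  · rw [ht]; exact h.trace_known
  · rw [ht]; exact fun r hr hrs => hc.subset (h.trace_strong r hr hrs)
  · rw [ht]; exact h.trace_sorted
  · exact h.awaiting_eq
  · exact h.awaiting_strong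
  · exact fun r hr hm =>
      h.awaiting_executed r hr ((longestCommonPrefix_prefix_left _ _).subset hm)

theorem insert (h : σ.Inv δ K) {r : Req n Op} (hr : r ∉ σ.committed)
    (hδ : ∀ x ∈ σ.committed, δ x < δ r) (hw : r.lvl = Level.weak) (hK : K r) :
    (insertIntoTentative σ r).Inv δ K := by
  rw [insertIntoTentative_eq]
  have hnd := List.nodup_append.1 h.order_nodup
  refine h.adjust (List.prefix_refl _) (List.nodup_append.2 ⟨hnd.1,
    nodup_insertedTentative r hnd.2.1, ?_⟩) h.committed_sorted ?_ ?_ ?_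
  · rintro a ha b hb rfl
    rcases mem_insertedTentative hb with rfl | hb
    · exact hr ha
    · exact hnd.2.2 a ha a hb rfl
  · intro x hx y hy
    rcases mem_insertedTentative hy with rfl | hy
    · exact hδ x hx
    · exact h.committed_lt x hx y hy
  · intro y hy
    rcases mem_insertedTentative hy with rfl | hy
    · exact hw
    · exact h.tentative_weak y hy
  · intro y hy
    rcases List.mem_append.1 hy with hy | hy
    · exact h.order_known y (List.mem_append_left _ hy)
    rcases mem_insertedTentative hy with rfl | hy
    · exact hK
    · exact h.order_known y (List.mem_append_right _ hy)

open Classical in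
theorem commit_eq (h : σ.Inv δ K) (r : Req n Op) :
    commit σ r = Outcome.mk (adjustExecution
      { σ with
        committed := σ.committed ++ [r]
        tentative := σ.tentative.filter (fun y => y ≠ r) }
      ((σ.committed ++ [r]) ++ σ.tentative.filter (fun y => y ≠ r))) none none none := by
  unfold ACT.commit
  dsimp only
  split_ifs with hr
  · have : σ.awaiting r = none := by
      by_contra hne
      exact h.awaiting_executed r hne ((longestCommonPrefix_prefix_left _ _).subset hr)
    simp [adjustExecution, this]
  · rfl

theorem commit (h : σ.Inv δ K) {r : Req n Op} (hr : r ∉ σ.committed)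
    (hδ : ∀ x ∈ σ.committed, δ x < δ r) (hδ' : ∀ y ∈ σ.tentative, y ≠ r → δ r < δ y)
    (hK : K r) : (ACT.commit σ r).next.Inv δ K := by
  classical
  rw [h.commit_eq]
  have hnd := List.nodup_append.1 h.order_nodup
  refine h.adjust (List.prefix_append _ _) (List.nodup_append.2 ⟨List.nodup_append.2
    ⟨hnd.1, List.nodup_singleton r, ?_⟩, hnd.2.1.filter _, ?_⟩) (List.pairwise_append.2
    ⟨h.committed_sorted, List.pairwise_singleton _ _, by simpa using hδ⟩) ?_ ?_ ?_
  · rintro a ha b hb rfl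
    exact hr (List.mem_singleton.1 hb ▸ ha)
  · rintro a ha b hb rfl
    simp only [List.mem_filter, decide_eq_true_eq] at hb
    rcases List.mem_append.1 ha with ha | ha
    · exact hnd.2.2 a ha a hb.1 rfl
    · exact hb.2 (List.mem_singleton.1 ha)
  · intro x hx y hy
    simp only [List.mem_filter, decide_eq_true_eq] at hy
    rcases List.mem_append.1 hx with hx | hx
    · exact h.committed_lt x hx y hy.1
    · exact List.mem_singleton.1 hx ▸ hδ' y hy.1 hy.2
  · exact fun y hy => h.tentative_weak y (List.mem_of_mem_filter hy)
  · intro y hy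
    rcases List.mem_append.1 hy with hy | hy
    · rcases List.mem_append.1 hy with hy | hy
      · exact h.order_known y (List.mem_append_left _ hy)
      · exact List.mem_singleton.1 hy ▸ hK
    · exact h.order_known y (List.mem_append_right _ (List.mem_of_mem_filter hy))

theorem setAwaiting (h : σ.Inv δ K) {r : Req n Op} (hr : r ∉ σ.executed)
    (hs : r.lvl = Level.strong) (c : ℕ) (f : Req n Op → Option (Option Val))
    (hf : ∀ s, f s = σ.awaiting s ∨ s = r ∧ f s = some none) :
    ({ σ with currEventNo := c, awaiting := f } : ReplicaState n Op Val State).Inv δ K :=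
  { h with
    awaiting_eq := fun s hne => by
      rcases hf s with e | ⟨rfl, e⟩
      · exact e.trans (h.awaiting_eq s (e ▸ hne))
      · exact e
    awaiting_strong := fun s hne => by
      rcases hf s with e | ⟨rfl, -⟩
      · exact h.awaiting_strong s (e ▸ hne)
      · exact hs
    awaiting_executed := fun s hne => by
      rcases hf s with e | ⟨rfl, -⟩
      · exact h.awaiting_executed s (e ▸ hne)
      · exact hr }

end ReplicaState.Inv

section Internal

variable (O : StateObject.{u, v, w} n Op Val) {τ : ReplicaState n Op Val O.State}
  {δ : Req n Op → ℕ} {K : Req n Op → Prop}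

/-- A rollback undoes the last request of the trace. -/
theorem trace_eq_of_toBeRolledBack {r : Req n Op} {l : List (Req n Op)}
    (hl : τ.toBeRolledBack = r :: l) :
    τ.trace = (rollbackStep O τ).next.trace ++ [r] := by
  simp [ReplicaState.trace, rollbackStep, hl]

theorem ReplicaState.Inv.rollbackStep (h : τ.Inv δ K) : (rollbackStep O τ).next.Inv δ K := by
  rcases hl : τ.toBeRolledBack with _ | ⟨r, l⟩
  · simpa only [ACT.rollbackStep, hl] using h
  have ht := trace_eq_of_toBeRolledBack O hl
  have hsub : (ACT.rollbackStep O τ).next.trace.Sublist τ.trace :=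
    ht ▸ List.sublist_append_left _ _
  have e : (ACT.rollbackStep O τ).next =
      { τ with state := O.rollback τ.state r, toBeRolledBack := l } := by
    simp [ACT.rollbackStep, hl]
  rw [e] at hsub ⊢
  exact { h with
    trace_nodup := h.trace_nodup.sublist hsub
    trace_known := fun x hx => h.trace_known x (hsub.subset hx)
    trace_strong := fun x hx => h.trace_strong x (hsub.subset hx)
    trace_sorted := h.trace_sorted.sublist hsub }

/-- The head of `toBeExecuted` awaits a response only if it is strong and committed; then the
response is returned at once. -/
theorem ReplicaState.Inv.executeStep_eq (h : τ.Inv δ K) {r : Req n Op} {l : List (Req n Op)}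
    (hl : τ.toBeExecuted = r :: l) :
    ∃ f, f r = none ∧ (∀ s, s ≠ r → f s = τ.awaiting s) ∧
    ACT.executeStep O τ =
      { next := { τ with
          state := (O.execute τ.state r).1
          executed := τ.executed ++ [r]
          toBeExecuted := l
          awaiting := f }
        reply := (τ.awaiting r).map fun _ => Reply.deferred r (O.execute τ.state r).2 } := by
  classical
  by_cases ha : τ.awaiting r = none
  · exact ⟨τ.awaiting, ha, fun _ _ => rfl, by simp [ACT.executeStep, hl, ha]⟩
  · have hc : r ∈ τ.committed := h.order_strong
      (by rw [← h.executed_append, hl]; simp) (h.awaiting_strong r ha)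
    refine ⟨Function.update τ.awaiting r none, by simp, fun s hs => by simp [hs], ?_⟩
    simp [ACT.executeStep, hl, hc, h.awaiting_eq r ha]

theorem ReplicaState.Inv.executeStep (h : τ.Inv δ K) (hb : τ.toBeRolledBack = []) :
    (executeStep O τ).next.Inv δ K := by
  rcases hl : τ.toBeExecuted with _ | ⟨r, l⟩
  · simpa only [ACT.executeStep, hl] using h
  obtain ⟨f, hf, hf', e⟩ := h.executeStep_eq O hl
  rw [e]
  have hord : (τ.executed ++ [r]) ++ l = τ.order := by
    rw [← h.executed_append, hl]; simp
  have ht : (τ.executed ++ [r]) ++ τ.toBeRolledBack.reverse = τ.executed ++ [r] := by simp [hb]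
  have hsub : (τ.executed ++ [r]).Sublist τ.order := hord ▸ List.sublist_append_left _ _
  have hfa : ∀ s, f s ≠ none → s ≠ r ∧ f s = τ.awaiting s := fun s hs =>
    have : s ≠ r := fun e => hs (e ▸ hf)
    ⟨this, hf' s this⟩
  exact { h with
    executed_append := hord
    trace_nodup := by
      dsimp only [ReplicaState.trace]; rw [ht]; exact h.order_nodup.sublist hsub
    trace_known := by
      dsimp only [ReplicaState.trace]; rw [ht]
      exact fun x hx => h.order_known x (hsub.subset hx)
    trace_strong := by
      dsimp only [ReplicaState.trace]; rw [ht]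
      exact fun x hx => h.order_strong (hsub.subset hx)
    trace_sorted := by
      dsimp only [ReplicaState.trace]; rw [ht]; exact h.order_sorted.sublist hsub
    awaiting_eq := fun s hs => by
      obtain ⟨-, e⟩ := hfa s hs
      exact e.trans (h.awaiting_eq s (e ▸ hs))
    awaiting_strong := fun s hs => by
      obtain ⟨-, e⟩ := hfa s hs
      exact h.awaiting_strong s (e ▸ hs)
    awaiting_executed := fun s hs => by
      obtain ⟨hne, e⟩ := hfa s hs
      have := h.awaiting_executed s (e ▸ hs)
      simp [this, hne] }

end Internal

end LocalState

/-! ### Steps of a run -/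

section Steps

variable {n : ℕ} {Op : Type u} {Val : Type v} {Client : Type x}
  (D : ReplicatedDataType Op Val) (O : StateObject.{u, v, w} n Op Val)

/-- The request formed by replica `i` in the state `σ` for an operation. -/
def newRequest {State : Type w} (i : Fin n) (time : ℤ) (o : Op) (l : Level)
    (σ : ReplicaState n Op Val State) : Req n Op where
  timestamp := time
  dot := (i, σ.currEventNo + 1)
  ctx := {d | ∃ s, (s ∈ σ.executed ∨ s ∈ σ.toBeRolledBack) ∧ s.dot = d}
  lvl := l
  op := o

theorem mem_newRequest_ctx {State : Type w} {i : Fin n} {time : ℤ} {o : Op} {l : Level}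
    {σ : ReplicaState n Op Val State} {d : Fin n × ℕ} :
    d ∈ (newRequest i time o l σ).ctx ↔ ∃ s ∈ σ.trace, s.dot = d := by
  simp [newRequest, ReplicaState.trace]

variable {D O} {i : Fin n} {time : ℤ} {o : Op} {σ : ReplicaState n Op Val O.State}

theorem invokeStep_readonly (ho : o ∈ D.readonlyops) :
    invokeStep D O i time o Level.weak σ =
      { next := { σ with state := (O.executeOp σ.state o).1 }
        reply := some (Reply.immediate (O.executeOp σ.state o).2) } := by
  simp [invokeStep, ho]

theorem invokeStep_weak (ho : o ∉ D.readonlyops) :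
    invokeStep D O i time o Level.weak σ =
      { next := insertIntoTentative
          { σ with
            currEventNo := σ.currEventNo + 1
            state := O.rollback
              (O.execute σ.state (newRequest i time o Level.weak σ)).1
              (newRequest i time o Level.weak σ) }
          (newRequest i time o Level.weak σ)
        rbCast := some (newRequest i time o Level.weak σ)
        tobCast := some (newRequest i time o Level.weak σ)
        reply := some (Reply.immediate
          (O.execute σ.state (newRequest i time o Level.weak σ)).2) } := by
  simp only [invokeStep, ho, if_false]
  rfl

open Classical in
theorem invokeStep_strong :
    invokeStep D O i time o Level.strong σ =
      { next := { σ with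
          currEventNo := σ.currEventNo + 1
          awaiting := Function.update σ.awaiting (newRequest i time o Level.strong σ)
            (some none) }
        tobCast := some (newRequest i time o Level.strong σ) } := rfl

theorem currEventNo_commit (σ : ReplicaState n Op Val O.State) (r : Req n Op) :
    (commit σ r).next.currEventNo = σ.currEventNo := by
  unfold commit; dsimp only; split_ifs
  · split <;> rfl
  · rfl

theorem committed_commit (σ : ReplicaState n Op Val O.State) (r : Req n Op) :
    (commit σ r).next.committed = σ.committed ++ [r] := by
  unfold commit; dsimp only; split_ifs
  · split <;> rfl
  · rfl

theorem currEventNo_le_step (ev : Event n Op Client) :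
    σ.currEventNo ≤ (step D O i time σ ev).next.currEventNo := by
  cases ev with
  | invoke c o l =>
    cases l with
    | weak =>
      by_cases ho : o ∈ D.readonlyops
      · simp [step, invokeStep_readonly ho]
      · simp [step, invokeStep_weak ho, insertIntoTentative, adjustExecution]
    | strong => simp [step, invokeStep_strong]
  | rbDeliver r =>
    simp only [step, rbDeliverStep]
    split_ifs
    · rfl
    · exact le_rfl
  | tobDeliver r => exact (currEventNo_commit σ r).ge
  | rollback =>
    simp only [step, rollbackStep]
    split <;> rfl
  | execute =>
    simp only [step, executeStep]
    split
    · rfl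
    · split_ifs <;> rfl

theorem committed_step {ev : Event n Op Client} (hev : ∀ r, ev ≠ Event.tobDeliver r) :
    (step D O i time σ ev).next.committed = σ.committed := by
  cases ev with
  | invoke c o l =>
    cases l with
    | weak =>
      by_cases ho : o ∈ D.readonlyops
      · simp [step, invokeStep_readonly ho]
      · simp [step, invokeStep_weak ho, insertIntoTentative, adjustExecution]
    | strong => simp [step, invokeStep_strong]
  | rbDeliver r =>
    simp only [step, rbDeliverStep]
    split_ifs
    · rfl
    · rfl
  | tobDeliver r => exact absurd rfl (hev r)
  | rollback =>
    simp only [step, rollbackStep]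
    split <;> rfl
  | execute =>
    simp only [step, executeStep]
    split
    · rfl
    · split_ifs <;> rfl

theorem tobCast_step {ev : Event n Op Client} {r : Req n Op} :
    (step D O i time σ ev).tobCast = some r ↔ ∃ c o l, ev = Event.invoke c o l ∧
      (l = Level.weak → o ∉ D.readonlyops) ∧ r = newRequest i time o l σ := by
  cases ev with
  | invoke c o l =>
    cases l with
    | weak =>
      by_cases ho : o ∈ D.readonlyops
      · simp [step, invokeStep_readonly ho]; grind
      · simp [step, invokeStep_weak ho]; grind
    | strong => simp [step, invokeStep_strong]; grind
  | rbDeliver r =>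
    simp only [step, rbDeliverStep]
    split_ifs <;> simp
  | tobDeliver r =>
    simp only [step, commit]
    split_ifs
    · split <;> simp
    · simp
  | rollback =>
    simp only [step, rollbackStep]
    split <;> simp
  | execute =>
    simp only [step, executeStep]
    split
    · simp
    · split_ifs <;> simp

theorem rbCast_step {ev : Event n Op Client} {r : Req n Op}
    (h : (step D O i time σ ev).rbCast = some r) :
    (step D O i time σ ev).tobCast = some r ∧ r.lvl = Level.weak := by
  cases ev with
  | invoke c o l =>
    cases l with
    | weak =>
      by_cases ho : o ∈ D.readonlyops
      · simp [step, invokeStep_readonly ho] at h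
      · simp only [step, invokeStep_weak ho] at h ⊢
        exact ⟨h, by rw [← Option.some.inj h]; rfl⟩
    | strong => simp [step, invokeStep_strong] at h
  | rbDeliver r =>
    simp only [step, rbDeliverStep] at h
    split_ifs at h
  | tobDeliver r =>
    simp only [step, commit] at h
    split_ifs at h
    split at h <;> simp at h
  | rollback =>
    simp only [step, rollbackStep] at h
    split at h <;> simp at h
  | execute =>
    simp only [step, executeStep] at h
    split at h
    · simp at h
    · split_ifs at h

end Steps

namespace Run

variable {n : ℕ} {Op : Type u} {Val : Type v} {Client : Type x} {ρ : Run n Op Client}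
  {D : ReplicatedDataType Op Val} {O : StateObject.{u, v, w} n Op Val}

theorem config_succ {t : ℕ} {i : Fin n} {ev : Event n Op Client} (h : ρ.event t = some (i, ev)) :
    ρ.config D O (t + 1) i = (step D O i (ρ.clock t) (ρ.config D O t i) ev).next := by
  simp [config, h]

theorem config_succ_of_forall_ne {t : ℕ} {i : Fin n} (h : ∀ ev, ρ.event t ≠ some (i, ev)) :
    ρ.config D O (t + 1) i = ρ.config D O t i := by
  rcases hev : ρ.event t with _ | ⟨j, ev⟩
  · simp [config, hev]
  · have : i ≠ j := by rintro rfl; exact h ev hev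
    simp [config, hev, this]

theorem outcome_eq_some {t : ℕ} {q : Outcome n Op Val O.State} :
    ρ.outcome D O t = some q ↔ ∃ i ev, ρ.event t = some (i, ev) ∧
      step D O i (ρ.clock t) (ρ.config D O t i) ev = q := by
  simp [outcome]

/-- Induction along a run for a property of the local state of one replica. -/
theorem config_induction {i : Fin n} {P : ℕ → ReplicaState n Op Val O.State → Prop} {t₀ : ℕ}
    (h0 : P t₀ (ρ.config D O t₀ i))
    (hmono : ∀ t σ, t₀ ≤ t → P t σ → (∀ ev, ρ.event t ≠ some (i, ev)) → P (t + 1) σ)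
    (hstep : ∀ t ev, t₀ ≤ t → P t (ρ.config D O t i) → ρ.event t = some (i, ev) →
      P (t + 1) (step D O i (ρ.clock t) (ρ.config D O t i) ev).next)
    {t : ℕ} (ht : t₀ ≤ t) : P t (ρ.config D O t i) := by
  induction t, ht using Nat.le_induction with
  | base => exact h0
  | succ t ht ih =>
    by_cases h : ∀ ev, ρ.event t ≠ some (i, ev)
    · rw [config_succ_of_forall_ne h]
      exact hmono t _ ht ih h
    · push Not at h
      obtain ⟨ev, hev⟩ := h
      rw [config_succ hev]
      exact hstep t ev ht ih hev

/-! ### Broadcast requests -/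

theorem tobCast_iff {t : ℕ} {r : Req n Op} :
    ρ.TOBCast D O t r ↔ ∃ i c o l, ρ.event t = some (i, Event.invoke c o l) ∧
      (l = Level.weak → o ∉ D.readonlyops) ∧
      r = newRequest i (ρ.clock t) o l (ρ.config D O t i) := by
  constructor
  · rintro ⟨q, hq, hr⟩
    obtain ⟨i, ev, hev, rfl⟩ := outcome_eq_some.1 hq
    obtain ⟨c, o, l, rfl, hl, rfl⟩ := tobCast_step.1 hr
    exact ⟨i, c, o, l, hev, hl, rfl⟩
  · rintro ⟨i, c, o, l, hev, hl, rfl⟩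
    exact ⟨_, outcome_eq_some.2 ⟨i, _, hev, rfl⟩, tobCast_step.2 ⟨c, o, l, rfl, hl, rfl⟩⟩

theorem RBCast.tobCast {t : ℕ} {r : Req n Op} (h : ρ.RBCast D O t r) :
    ρ.TOBCast D O t r ∧ r.lvl = Level.weak := by
  obtain ⟨q, hq, hr⟩ := h
  obtain ⟨i, ev, hev, rfl⟩ := outcome_eq_some.1 hq
  obtain ⟨h1, h2⟩ := rbCast_step hr
  exact ⟨⟨_, hq, h1⟩, h2⟩

theorem TOBCast.inj_right {t : ℕ} {r s : Req n Op} (hr : ρ.TOBCast D O t r)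
    (hs : ρ.TOBCast D O t s) : r = s := by
  obtain ⟨q, hq, hr⟩ := hr
  obtain ⟨q', hq', hs⟩ := hs
  simp_all

theorem currEventNo_mono {i : Fin n} {s t : ℕ} (h : s ≤ t) :
    (ρ.config D O s i).currEventNo ≤ (ρ.config D O t i).currEventNo := by
  refine config_induction (P := fun _ σ => (ρ.config D O s i).currEventNo ≤ σ.currEventNo)
    le_rfl (fun _ _ _ h _ => h) (fun t ev _ h _ => h.trans (currEventNo_le_step ev)) h

theorem TOBCast.dot_eq {t : ℕ} {r : Req n Op} (h : ρ.TOBCast D O t r) :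
    r.dot.2 = (ρ.config D O t r.dot.1).currEventNo + 1 := by
  obtain ⟨i, c, o, l, -, -, rfl⟩ := tobCast_iff.1 h
  rfl

theorem TOBCast.dot_le {t : ℕ} {r : Req n Op} (h : ρ.TOBCast D O t r) :
    r.dot.2 ≤ (ρ.config D O (t + 1) r.dot.1).currEventNo := by
  obtain ⟨i, c, o, l, hev, hl, rfl⟩ := tobCast_iff.1 h
  simp only [newRequest]
  rw [config_succ hev]
  cases l with
  | weak => simp [step, invokeStep_weak (hl rfl), insertIntoTentative, adjustExecution]
  | strong => simp [step, invokeStep_strong]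

theorem TOBCast.not_lt_of_dot_eq {s t : ℕ} {r q : Req n Op} (hr : ρ.TOBCast D O s r)
    (hq : ρ.TOBCast D O t q) (h : r.dot = q.dot) : ¬ s < t := by
  intro hst
  have h1 := hr.dot_le
  have h2 := hq.dot_eq
  have h3 : (ρ.config D O (s + 1) r.dot.1).currEventNo ≤ (ρ.config D O t r.dot.1).currEventNo :=
    currEventNo_mono hst
  rw [h] at h1 h3
  omega

/-- Requests are identified by their dots, also across replicas. -/
theorem TOBCast.eq_of_dot_eq {s t : ℕ} {r q : Req n Op} (hr : ρ.TOBCast D O s r)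
    (hq : ρ.TOBCast D O t q) (h : r.dot = q.dot) : s = t ∧ r = q := by
  have : s = t := le_antisymm (not_lt.1 (hq.not_lt_of_dot_eq hr h.symm))
    (not_lt.1 (hr.not_lt_of_dot_eq hq h))
  subst this
  exact ⟨rfl, hr.inj_right hq⟩

theorem TOBCast.inj_left {s t : ℕ} {r : Req n Op} (hr : ρ.TOBCast D O s r)
    (hq : ρ.TOBCast D O t r) : s = t :=
  (hr.eq_of_dot_eq hq rfl).1

/-- `r` has been broadcast before instant `t`. -/
def Known (ρ : Run n Op Client) (D : ReplicatedDataType Op Val)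
    (O : StateObject.{u, v, w} n Op Val) (t : ℕ) (r : Req n Op) : Prop :=
  ∃ s, s < t ∧ ρ.TOBCast D O s r

theorem Known.mono {s t : ℕ} {r : Req n Op} (h : ρ.Known D O s r) (hst : s ≤ t) :
    ρ.Known D O t r :=
  let ⟨k, hk, hr⟩ := h
  ⟨k, hk.trans_le hst, hr⟩

/-! ### The commit order -/

/-- The instant at which `r` is delivered by total-order broadcast for the first time, by any
replica (`0` if it is never delivered). -/
noncomputable def firstDelivery (ρ : Run n Op Client) (r : Req n Op) : ℕ :=
  sInf {t | ∃ i, ρ.TOBDelivers i t r}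

theorem firstDelivery_le {i : Fin n} {t : ℕ} {r : Req n Op} (h : ρ.TOBDelivers i t r) :
    ρ.firstDelivery r ≤ t :=
  Nat.sInf_le ⟨i, h⟩

theorem exists_tobDelivers_firstDelivery (htob : ρ.StableTotalOrderBroadcast D O)
    {t : ℕ} {r : Req n Op} (h : ρ.TOBCast D O t r) :
    ∃ i, ρ.TOBDelivers i (ρ.firstDelivery r) r := by
  obtain ⟨i, -⟩ := tobCast_iff.1 h
  obtain ⟨s, hs⟩ := htob.delivery t r h i
  exact Nat.sInf_mem (s := {t | ∃ i, ρ.TOBDelivers i t r}) ⟨s, i, hs⟩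

theorem lt_firstDelivery (htob : ρ.StableTotalOrderBroadcast D O)
    {t : ℕ} {r : Req n Op} (h : ρ.TOBCast D O t r) :
    t < ρ.firstDelivery r := by
  obtain ⟨i, hi⟩ := exists_tobDelivers_firstDelivery htob h
  obtain ⟨s, hs, hr⟩ := htob.integrity i _ r hi
  exact h.inj_left hr ▸ hs

theorem firstDelivery_inj (htob : ρ.StableTotalOrderBroadcast D O)
    {s t : ℕ} {r q : Req n Op} (hr : ρ.TOBCast D O s r)
    (hq : ρ.TOBCast D O t q) (h : ρ.firstDelivery r = ρ.firstDelivery q) : r = q := by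
  obtain ⟨i, hi⟩ := exists_tobDelivers_firstDelivery htob hr
  obtain ⟨j, hj⟩ := exists_tobDelivers_firstDelivery htob hq
  unfold TOBDelivers at hi hj
  rw [h, hj] at hi
  simp at hi
  exact hi.2.symm

/-- The instants of first delivery increase along the common delivery order: the replica which is
the first to deliver `q` has delivered `r` before. -/
theorem firstDelivery_lt (htob : ρ.StableTotalOrderBroadcast D O)
    {i : Fin n} {s t : ℕ} {r q : Req n Op} (hr : ρ.TOBDelivers i s r)
    (hq : ρ.TOBDelivers i t q) (h : s < t) : ρ.firstDelivery r < ρ.firstDelivery q := by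
  obtain ⟨a, -, ha⟩ := htob.integrity i s r hr
  obtain ⟨b, -, hb⟩ := htob.integrity i t q hq
  obtain ⟨j, hj⟩ := exists_tobDelivers_firstDelivery htob hb
  obtain ⟨s', hs'⟩ := htob.delivery a r ha j
  exact (firstDelivery_le hs').trans_lt (htob.total_order i j s t s' _ r q hr hq hs' hj h)

theorem tobDelivers_lt_of_firstDelivery_lt (htob : ρ.StableTotalOrderBroadcast D O)
    {i : Fin n} {s t : ℕ} {r q : Req n Op}
    (hr : ρ.TOBDelivers i s r) (hq : ρ.TOBDelivers i t q)
    (h : ρ.firstDelivery r < ρ.firstDelivery q) : s < t := by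
  rcases lt_trichotomy s t with hst | rfl | hst
  · exact hst
  · unfold TOBDelivers at hr hq
    rw [hr] at hq
    simp at hq
    simp [hq] at h
  · exact absurd (firstDelivery_lt htob hq hr hst) h.asymm

theorem mem_committed {t : ℕ} {i : Fin n} {r : Req n Op} :
    r ∈ (ρ.config D O t i).committed ↔ ∃ s, s < t ∧ ρ.TOBDelivers i s r := by
  refine config_induction (i := i) (t₀ := 0)
    (P := fun t σ => r ∈ σ.committed ↔ ∃ s, s < t ∧ ρ.TOBDelivers i s r)
    (by simp [config, initialState]) ?_ ?_ (Nat.zero_le t)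
  · intro t σ _ ih hev
    rw [ih]
    have : ¬ ρ.TOBDelivers i t r := hev _
    simp only [Nat.lt_succ_iff_lt_or_eq, or_and_right, exists_or, exists_eq_left, this, or_false]
  · intro t ev _ ih hev
    simp only [Nat.lt_succ_iff_lt_or_eq, or_and_right, exists_or, exists_eq_left, ← ih]
    by_cases h : ∃ q, ev = Event.tobDeliver q
    · obtain ⟨q, rfl⟩ := h
      simp only [step, committed_commit, List.mem_append, List.mem_singleton, TOBDelivers, hev]
      grind
    · push Not at h
      rw [committed_step h]
      have : ¬ ρ.TOBDelivers i t r := by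
        intro hd
        unfold TOBDelivers at hd
        rw [hev] at hd
        simp at hd
        exact h r hd
      simp [this]

/-- A request that a replica has committed precedes in the commit order those that it has not. -/
theorem firstDelivery_lt_of_notMem_committed (htob : ρ.StableTotalOrderBroadcast D O) {t : ℕ}
    {i : Fin n} {x y : Req n Op} (hx : x ∈ (ρ.config D O t i).committed)
    (hy : y ∉ (ρ.config D O t i).committed) (hcast : ∃ s, ρ.TOBCast D O s y) :
    ρ.firstDelivery x < ρ.firstDelivery y := by
  obtain ⟨s, hs, hx⟩ := mem_committed.1 hx
  obtain ⟨a, ha⟩ := hcast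
  obtain ⟨k, hk⟩ := htob.delivery a y ha i
  have : t ≤ k := not_lt.1 fun h => hy (mem_committed.2 ⟨k, h, hk⟩)
  exact firstDelivery_lt htob hx hk (hs.trans_le this)

/-- The invariants of a stable run which do not depend on the state object. -/
theorem inv {lvlmap : Op → Set Level} (hρ : ρ.IsStable D O lvlmap) (t : ℕ) (i : Fin n) :
    (ρ.config D O t i).Inv ρ.firstDelivery (ρ.Known D O t) := by
  refine config_induction (i := i) (t₀ := 0)
    (P := fun t σ => σ.Inv ρ.firstDelivery (ρ.Known D O t)) ?_ ?_ ?_ (Nat.zero_le t)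
  · constructor <;> simp [config, initialState, ReplicaState.order, ReplicaState.trace]
  · exact fun t σ _ ih _ => ih.mono fun r hr => hr.mono t.le_succ
  · intro t ev _ ih hev
    have ih' := ih.mono (K' := ρ.Known D O (t + 1)) fun r hr => hr.mono t.le_succ
    cases ev with
    | invoke c o l =>
      cases l with
      | weak =>
        by_cases ho : o ∈ D.readonlyops
        · simp only [step, invokeStep_readonly ho]
          exact ih'.setState _ _
        · have hcast : ρ.TOBCast D O t _ := tobCast_iff.2 ⟨i, c, o, _, hev, fun _ => ho, rfl⟩
          simp only [step, invokeStep_weak ho]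
          suffices hmem : newRequest i (ρ.clock t) o Level.weak (ρ.config D O t i) ∉
              (ρ.config D O t i).committed from
            (ih'.setState _ _).insert hmem
              (fun x hx => firstDelivery_lt_of_notMem_committed hρ.tob hx hmem ⟨t, hcast⟩) rfl
              ⟨t, t.lt_succ_self, hcast⟩
          intro hmem
          obtain ⟨s, hs, hs'⟩ := ih.order_known _ (List.mem_append_left _ hmem)
          exact hs.ne (hs'.inj_left hcast)
      | strong =>
        have hcast : ρ.TOBCast D O t _ :=
          tobCast_iff.2 ⟨i, c, o, Level.strong, hev, fun h => by simp at h, rfl⟩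
        simp only [step, invokeStep_strong]
        refine ih'.setAwaiting (r := newRequest i (ρ.clock t) o Level.strong (ρ.config D O t i))
          ?_ rfl _ _ ?_
        · intro hmem
          obtain ⟨s, hs, hs'⟩ := ih.trace_known _ (List.mem_append_left _ hmem)
          exact hs.ne (hs'.inj_left hcast)
        · intro s
          simp only [Function.update_apply]
          split_ifs with h
          · exact Or.inr ⟨h, rfl⟩
          · exact Or.inl rfl
    | rbDeliver r =>
      simp only [step, rbDeliverStep]
      split_ifs with h
      · exact ih'
      · push Not at h
        obtain ⟨s, hs, hr⟩ := hρ.rb.integrity i t r hev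
        exact ih'.insert h.2
          (fun x hx => firstDelivery_lt_of_notMem_committed hρ.tob hx h.2 ⟨s, hr.tobCast.1⟩)
          hr.tobCast.2 ⟨s, hs.trans t.lt_succ_self, hr.tobCast.1⟩
    | tobDeliver r =>
      obtain ⟨s, hs, hr⟩ := hρ.tob.integrity i t r hev
      refine ih'.commit ?_ ?_ ?_ ⟨s, hs.trans t.lt_succ_self, hr⟩
      · intro hmem
        obtain ⟨k, hk, hk'⟩ := mem_committed.1 hmem
        exact hk.ne (hρ.tob.no_duplication i k t r hk' hev)
      · intro x hx
        obtain ⟨k, hk, hk'⟩ := mem_committed.1 hx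
        exact firstDelivery_lt hρ.tob hk' hev hk
      · intro y hy hyr
        obtain ⟨a, -, ha⟩ := ih.order_known y (List.mem_append_right _ hy)
        refine firstDelivery_lt_of_notMem_committed hρ.tob (t := t + 1) (i := i)
          (mem_committed.2 ⟨t, t.lt_succ_self, hev⟩) ?_ ⟨a, ha⟩
        rw [config_succ hev, step, committed_commit, List.mem_append, List.mem_singleton]
        rintro (hc | hc)
        · exact (List.nodup_append.1 ih.order_nodup).2.2 y hc y hy rfl
        · exact hyr hc
    | rollback => exact ih'.rollbackStep O
    | execute => exact ih'.executeStep O (hρ.execution.execute_enabled t i hev).1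

end Run

/-! ### Acyclic relations and the state of the object -/

theorem Acyclic.of_lt {A : Type*} {rel : A → A → Prop} (f : A → ℕ)
    (h : ∀ a b, rel a b → f a < f b) : Acyclic rel := by
  intro a ha
  have : ∀ b, Relation.TransGen rel a b → f a < f b := by
    intro b hb
    induction hb with
    | single hab => exact h _ _ hab
    | tail _ hbc ih => exact ih.trans (h _ _ hbc)
  exact lt_irrefl _ (this a ha)

theorem trace_insertIntoTentative {n : ℕ} {Op : Type u} {Val : Type v} {State : Type w}
    (σ : ReplicaState n Op Val State) (r : Req n Op) (h : σ.executed.Nodup) :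
    (insertIntoTentative σ r).trace = σ.trace :=
  trace_adjustExecution { σ with tentative := _ } _ h

/-- The state of the object is `S α` when `α` is the trace. -/
def StateObject.TracedBy {n : ℕ} {Op : Type u} {Val : Type v}
    (O : StateObject.{u, v, w} n Op Val) (D : ReplicatedDataType Op Val)
    (S : List (Req n Op) → O.State) : Prop :=
  S [] = O.init ∧
  (∀ α (hα : ValidTrace α) r, ValidTrace (α ++ [r]) →
    O.execute (S α) r = (S (α ++ [r]), D.F r.op (traceContext α hα))) ∧
  (∀ α r, ValidTrace (α ++ [r]) → O.rollback (S (α ++ [r])) r = S α) ∧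
  (∀ α (hα : ValidTrace α), ∀ o ∈ D.readonlyops,
    O.executeOp (S α) o = (S α, D.F o (traceContext α hα)))

namespace Run

variable {n : ℕ} {Op : Type u} {Val : Type v} {Client : Type x} {ρ : Run n Op Client}
  {D : ReplicatedDataType Op Val} {O : StateObject.{u, v, w} n Op Val}
  {lvlmap : Op → Set Level}

/-! ### Traces are valid -/

/-- A request in a trace has been broadcast before and, if it is strong, has also been
delivered before. -/
theorem lt_of_mem_trace (hρ : ρ.IsStable D O lvlmap) {s t : ℕ} {i : Fin n} {r : Req n Op}
    (hr : ρ.TOBCast D O s r) (h : r ∈ (ρ.config D O t i).trace) :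
    s < t ∧ (r.lvl = Level.strong → ρ.firstDelivery r < t) := by
  obtain ⟨k, hk, hk'⟩ := (inv hρ t i).trace_known r h
  refine ⟨hr.inj_left hk' ▸ hk, fun hs => ?_⟩
  obtain ⟨k, hk, hk'⟩ := mem_committed.1 ((inv hρ t i).trace_strong r h hs)
  exact (firstDelivery_le hk').trans_lt hk

/-- Membership in the context of a request determines membership in the trace at the moment of
its invocation. -/
theorem mem_ctx_iff (hρ : ρ.IsStable D O lvlmap) {s t : ℕ} {i : Fin n} {r q : Req n Op}
    {o : Op} {l : Level} (hr : ρ.TOBCast D O s r)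
    (hq : q = newRequest i (ρ.clock t) o l (ρ.config D O t i)) :
    r.dot ∈ q.ctx ↔ r ∈ (ρ.config D O t i).trace := by
  rw [hq, mem_newRequest_ctx]
  constructor
  · rintro ⟨x, hx, hd⟩
    obtain ⟨k, -, hk⟩ := (inv hρ t i).trace_known x hx
    exact (hk.eq_of_dot_eq hr hd).2 ▸ hx
  · exact fun h => ⟨r, h, rfl⟩

/-- Visibility in such a list increases the following number: the instant of the invocation for
weak requests and that of the first delivery for strong ones. -/
theorem validTrace (hρ : ρ.IsStable D O lvlmap) {α : List (Req n Op)} (hnd : α.Nodup)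
    (hK : ∀ r ∈ α, ∃ s, ρ.TOBCast D O s r)
    (hs : α.Pairwise (fun x y => x.lvl = Level.strong ∨ y.lvl = Level.strong →
      ρ.firstDelivery x < ρ.firstDelivery y)) : ValidTrace α := by
  refine ⟨hnd, ?_⟩
  choose c hc using fun i : Fin α.length => hK (α.get i) (List.get_mem α i)
  refine Acyclic.of_lt (fun i => match (α.get i).lvl with
    | Level.weak => c i
    | Level.strong => ρ.firstDelivery (α.get i)) ?_
  intro i j hij
  unfold traceVis at hij
  rcases hj : (α.get j).lvl with _ | _
  · simp only [hj] at hij ⊢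
    obtain ⟨k, _, o, l, -, -, hq⟩ := tobCast_iff.1 (hc j)
    obtain ⟨h1, h2⟩ := lt_of_mem_trace hρ (hc i) ((mem_ctx_iff hρ (hc i) hq).1 hij)
    rcases hi : (α.get i).lvl with _ | _
    · exact h1
    · exact h2 hi
  · simp only [hj] at hij ⊢
    have hlt := List.pairwise_iff_get.1 hs i j hij (Or.inr hj)
    rcases hi : (α.get i).lvl with _ | _
    · exact (lt_firstDelivery hρ.tob (hc i)).trans hlt
    · exact hlt

theorem validTrace_trace (hρ : ρ.IsStable D O lvlmap) (t : ℕ) (i : Fin n) :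
    ValidTrace (ρ.config D O t i).trace :=
  have h := inv hρ t i
  validTrace hρ h.trace_nodup
    (fun r hr => let ⟨s, _, hs⟩ := h.trace_known r hr; ⟨s, hs⟩) h.trace_sorted

theorem validTrace_trace_append (hρ : ρ.IsStable D O lvlmap) {t : ℕ} (i : Fin n) {r : Req n Op}
    (hr : ρ.TOBCast D O t r) (hw : r.lvl = Level.weak) :
    ValidTrace ((ρ.config D O t i).trace ++ [r]) := by
  have h := inv hρ t i
  refine validTrace hρ (List.nodup_append.2 ⟨h.trace_nodup, List.nodup_singleton r, ?_⟩) ?_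
    (List.pairwise_append.2 ⟨h.trace_sorted, List.pairwise_singleton _ _, ?_⟩)
  · rintro a ha b hb rfl
    exact ((lt_of_mem_trace hρ hr (List.mem_singleton.1 hb ▸ ha)).1).ne rfl
  · intro x hx
    rcases List.mem_append.1 hx with hx | hx
    · obtain ⟨s, _, hs⟩ := h.trace_known x hx
      exact ⟨s, hs⟩
    · exact ⟨t, List.mem_singleton.1 hx ▸ hr⟩
  · intro x hx y hy hs
    have hxs : x.lvl = Level.strong := hs.resolve_right (by
      rw [List.mem_singleton.1 hy, hw]; simp)
    obtain rfl := List.mem_singleton.1 hy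
    obtain ⟨k, -, hk⟩ := h.trace_known x hx
    exact ((lt_of_mem_trace hρ hk hx).2 hxs).trans (lt_firstDelivery hρ.tob hr)

theorem validTrace_prefix_order (hρ : ρ.IsStable D O lvlmap) {t : ℕ} {i : Fin n}
    {α : List (Req n Op)} (hα : α <+: (ρ.config D O t i).order) : ValidTrace α :=
  have h := inv hρ t i
  validTrace hρ (h.order_nodup.sublist hα.sublist)
    (fun r hr => let ⟨s, _, hs⟩ := h.order_known r (hα.subset hr); ⟨s, hs⟩)
    (h.order_sorted.sublist hα.sublist)

/-! ### The state object -/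

theorem state_eq (hρ : ρ.IsStable D O lvlmap) {S : List (Req n Op) → O.State}
    (hS : O.TracedBy D S) (t : ℕ) (i : Fin n) :
    (ρ.config D O t i).state = S (ρ.config D O t i).trace := by
  obtain ⟨hS0, hSe, hSr, hSo⟩ := hS
  refine config_induction (i := i) (t₀ := 0) (P := fun t σ => σ.state = S σ.trace)
    ?_ (fun _ _ _ h _ => h) ?_ (Nat.zero_le t)
  · simp [config, initialState, ReplicaState.trace, hS0]
  · intro t ev _ ih hev
    have h := inv hρ t i
    have hv := validTrace_trace hρ t i
    cases ev with
    | invoke c o l =>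
      cases l with
      | weak =>
        by_cases ho : o ∈ D.readonlyops
        · simp only [step, invokeStep_readonly ho]
          rw [ih, hSo _ hv o ho]
          rfl
        · have hcast : ρ.TOBCast D O t _ := tobCast_iff.2 ⟨i, c, o, _, hev, fun _ => ho, rfl⟩
          have hva := validTrace_trace_append hρ i hcast rfl
          simp only [step, invokeStep_weak ho]
          rw [trace_insertIntoTentative]
          · change O.rollback (O.execute (ρ.config D O t i).state _).1 _ =
              S (ρ.config D O t i).trace
            rw [ih, hSe _ hv _ hva, hSr _ _ hva]
          · exact h.executed_nodup
      | strong => exact ih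
    | rbDeliver r =>
      simp only [step, rbDeliverStep]
      split_ifs
      · exact ih
      · rw [trace_insertIntoTentative _ _ h.executed_nodup]
        exact ih
    | tobDeliver r =>
      simp only [step, h.commit_eq]
      rw [trace_adjustExecution]
      · exact ih
      · exact h.executed_nodup
    | rollback =>
      obtain ⟨r, l, hl⟩ := List.exists_cons_of_ne_nil (hρ.execution.rollback_enabled t i hev)
      have ht := trace_eq_of_toBeRolledBack O hl
      rw [ht] at ih hv
      have hr := hSr _ _ hv
      rw [← ih] at hr
      rw [step, ← hr]
      simp [rollbackStep, hl]
    | execute =>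
      obtain ⟨hb, hne⟩ := hρ.execution.execute_enabled t i hev
      obtain ⟨r, l, hl⟩ := List.exists_cons_of_ne_nil hne
      obtain ⟨f, -, -, e⟩ := h.executeStep_eq O hl
      have hva : ValidTrace ((ρ.config D O t i).trace ++ [r]) := by
        refine validTrace_prefix_order hρ (t := t) (i := i) ⟨l, ?_⟩
        rw [← h.executed_append, hl]
        simp [ReplicaState.trace, hb]
      simp only [step, e, ih, hSe _ hv _ hva]
      simp [ReplicaState.trace, hb]

/-! ### Answers -/

/-- A deferred response is given by the step which executes the request. -/
theorem deferred_reply (hρ : ρ.IsStable D O lvlmap) {k : ℕ} {q : Outcome n Op Val O.State}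
    {r : Req n Op} {y : Val} (hq : ρ.outcome D O k = some q)
    (hrep : q.reply = some (Reply.deferred r y)) :
    ∃ j l, ρ.event k = some (j, Event.execute) ∧
      (ρ.config D O k j).toBeExecuted = r :: l ∧ (ρ.config D O k j).awaiting r ≠ none ∧
      y = (O.execute (ρ.config D O k j).state r).2 := by
  obtain ⟨j, ev, hev', rfl⟩ := outcome_eq_some.1 hq
  have h := inv hρ k j
  cases ev with
  | invoke c' o' l =>
    cases l with
    | weak =>
      by_cases ho : o' ∈ D.readonlyops
      · simp [step, invokeStep_readonly ho] at hrep
      · simp [step, invokeStep_weak ho] at hrep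
    | strong => simp [step, invokeStep_strong] at hrep
  | rbDeliver r' =>
    simp only [step, rbDeliverStep] at hrep
    split_ifs at hrep
  | tobDeliver r' => simp [step, h.commit_eq] at hrep
  | rollback =>
    simp only [step, rollbackStep] at hrep
    split at hrep <;> simp at hrep
  | execute =>
    obtain ⟨r', l, hl⟩ := List.exists_cons_of_ne_nil
      (hρ.execution.execute_enabled k j hev').2
    obtain ⟨f, -, -, e⟩ := h.executeStep_eq O hl
    simp only [step, e, Option.map_eq_some_iff, Reply.deferred.injEq] at hrep
    obtain ⟨a, ha, rfl, rfl⟩ := hrep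
    exact ⟨j, l, hev', hl, by simp [ha], rfl⟩

theorem answered_weak_iff (hρ : ρ.IsStable D O lvlmap) (hO : O.Implements D) {t k : ℕ}
    {i : Fin n} {c : Client} {o : Op} {y : Val}
    (hev : ρ.event t = some (i, Event.invoke c o Level.weak)) :
    ρ.Answered D O t k y ↔
      k = t ∧ y = D.F o (traceContext (ρ.config D O t i).trace (validTrace_trace hρ t i)) := by
  obtain ⟨S, hS⟩ := hO
  have hst := state_eq hρ hS t i
  obtain ⟨-, hSe, -, hSo⟩ := hS
  have hv := validTrace_trace hρ t i
  have himm : ∃ q, ρ.outcome D O t = some q ∧ q.reply = some (Reply.immediate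
      (D.F o (traceContext (ρ.config D O t i).trace hv))) := by
    refine ⟨_, outcome_eq_some.2 ⟨i, _, hev, rfl⟩, ?_⟩
    by_cases ho : o ∈ D.readonlyops
    · simp only [step, invokeStep_readonly ho]
      rw [hst, hSo _ hv o ho]
    · have hcast : ρ.TOBCast D O t _ := tobCast_iff.2 ⟨i, c, o, _, hev, fun _ => ho, rfl⟩
      simp only [step, invokeStep_weak ho]
      rw [hst, hSe _ hv _ (validTrace_trace_append hρ i hcast rfl)]
      rfl
  obtain ⟨q, hq, hr⟩ := himm
  constructor
  · rintro (⟨q', hq', hr', rfl⟩ | ⟨r, q', hr', -, hq', hrep⟩)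
    · rw [hq] at hq'
      obtain rfl := Option.some.inj hq'
      rw [hr] at hr'
      simpa using hr'.symm
    · -- the response to a weak request is never deferred, since the request awaits none
      exfalso
      have hw : r.lvl = Level.weak := by
        obtain ⟨j, c', o', l', hev', -, rfl⟩ := tobCast_iff.1 hr'
        rw [hev] at hev'
        simp only [Option.some.injEq, Prod.mk.injEq, Event.invoke.injEq] at hev'
        exact hev'.2.2.2.symm
      obtain ⟨j, l, -, -, ha, -⟩ := deferred_reply hρ hq' hrep
      have := (inv hρ k j).awaiting_strong r ha
      rw [hw] at this
      simp at this
  · rintro ⟨rfl, rfl⟩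
    exact Or.inl ⟨q, hq, hr, rfl⟩

/-- The requests which come before `r` in the commit order, in this order. -/
structure IsCommitPrefix (ρ : Run n Op Client) (D : ReplicatedDataType Op Val)
    (O : StateObject.{u, v, w} n Op Val) (r : Req n Op) (α : List (Req n Op)) : Prop where
  mem_iff : ∀ x, x ∈ α ↔ (∃ s, ρ.TOBCast D O s x) ∧ ρ.firstDelivery x < ρ.firstDelivery r
  sorted : α.Pairwise (fun x y => ρ.firstDelivery x < ρ.firstDelivery y)

/-- When a replica executes a request that it has committed, the requests executed before are
those which precede it in the commit order. -/
theorem isCommitPrefix_executed (hρ : ρ.IsStable D O lvlmap) {k : ℕ} {j : Fin n} {r : Req n Op}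
    {l : List (Req n Op)} (hl : (ρ.config D O k j).toBeExecuted = r :: l)
    (hr : r ∈ (ρ.config D O k j).committed) :
    ρ.IsCommitPrefix D O r (ρ.config D O k j).executed := by
  have h := inv hρ k j
  obtain ⟨c₁, c₂, hc⟩ := List.append_of_mem hr
  have hord := h.executed_append
  have hnd := h.order_nodup
  rw [hl] at hord
  have hr1 : r ∉ (ρ.config D O k j).executed := by
    rw [← hord, List.nodup_append] at hnd
    exact fun hm => hnd.2.2 r hm r (by simp) rfl
  have hr2 : r ∉ c₁ := by
    rw [ReplicaState.order, hc, List.append_assoc, List.nodup_append] at hnd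
    exact fun hm => hnd.2.2 r hm r (by simp) rfl
  have he : (ρ.config D O k j).executed = c₁ := by
    rw [ReplicaState.order, hc, List.append_assoc, List.cons_append,
      List.append_eq_append_iff] at hord
    rcases hord with ⟨a, h1, h2⟩ | ⟨a, h1, h2⟩
    · rcases a with _ | ⟨b, a⟩
      · simpa using h1.symm
      · obtain rfl : r = b := by simpa using (List.cons.inj h2).1
        exact absurd (by rw [h1]; simp) hr2
    · rcases a with _ | ⟨b, a⟩
      · simpa using h1
      · obtain rfl : r = b := by simpa using (List.cons.inj h2).1
        exact absurd (by rw [h1]; simp) hr1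
  have hs := h.committed_sorted
  rw [hc, List.pairwise_append, List.pairwise_cons] at hs
  rw [he]
  refine ⟨fun x => ⟨fun hx => ?_, ?_⟩, hs.1⟩
  · obtain ⟨s, -, hs'⟩ := h.order_known x (List.mem_append_left _ (by rw [hc]; simp [hx]))
    exact ⟨⟨s, hs'⟩, hs.2.2 x hx r (by simp)⟩
  · rintro ⟨⟨s, hx⟩, hlt⟩
    obtain ⟨s₁, h1⟩ := hρ.tob.delivery s x hx j
    obtain ⟨s₂, hk, h2⟩ := mem_committed.1 hr
    have hxc : x ∈ (ρ.config D O k j).committed := mem_committed.2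
      ⟨s₁, (tobDelivers_lt_of_firstDelivery_lt hρ.tob h1 h2 hlt).trans hk, h1⟩
    rw [hc, List.mem_append, List.mem_cons] at hxc
    rcases hxc with hxc | rfl | hxc
    · exact hxc
    · exact absurd hlt (lt_irrefl _)
    · exact absurd hlt (hs.2.1.1 x hxc).asymm

/-- An answer to a strong operation is given after its request has been committed, in the context
of all requests before it in the commit order. -/
theorem answered_strong (hρ : ρ.IsStable D O lvlmap) (hO : O.Implements D) {t k : ℕ}
    {r : Req n Op} {y : Val} (hr : ρ.TOBCast D O t r) (hs : r.lvl = Level.strong)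
    (h : ρ.Answered D O t k y) :
    ρ.firstDelivery r < k ∧ ∃ α, ∃ hα : ValidTrace α, ρ.IsCommitPrefix D O r α ∧
      y = D.F r.op (traceContext α hα) := by
  rcases h with ⟨q, hq, hrep, -⟩ | ⟨r', q, hr', -, hq, hrep⟩
  · exfalso
    obtain ⟨i, c, o, l, hev, -, rfl⟩ := tobCast_iff.1 hr
    obtain rfl : l = Level.strong := hs
    obtain ⟨j, ev, hev', rfl⟩ := outcome_eq_some.1 hq
    rw [hev] at hev'
    simp only [Option.some.injEq, Prod.mk.injEq] at hev'
    obtain ⟨rfl, rfl⟩ := hev'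
    simp [step, invokeStep_strong] at hrep
  · obtain rfl := hr.inj_right hr'
    obtain ⟨j, l, hev, hl, ha, rfl⟩ := deferred_reply hρ hq hrep
    have hi := inv hρ k j
    have hrc : r ∈ (ρ.config D O k j).committed :=
      hi.order_strong (by rw [← hi.executed_append, hl]; simp) hs
    obtain ⟨s, hsk, hd⟩ := mem_committed.1 hrc
    have hv := validTrace_prefix_order hρ hi.executed_prefix
    have hva : ValidTrace ((ρ.config D O k j).executed ++ [r]) :=
      validTrace_prefix_order hρ (t := k) (i := j)
        ⟨l, by rw [← hi.executed_append, hl]; simp⟩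
    refine ⟨(firstDelivery_le hd).trans_lt hsk, _, hv, isCommitPrefix_executed hρ hl hrc, ?_⟩
    obtain ⟨S, hS⟩ := hO
    have hb := (hρ.execution.execute_enabled k j hev).1
    rw [state_eq hρ hS, ReplicaState.trace, hb, List.reverse_nil, List.append_nil,
      hS.2.1 _ hv _ hva]

/-- A strong request stays in the map of the requests awaiting a response until it is
answered. -/
theorem awaiting_or_answered (hρ : ρ.IsStable D O lvlmap) {t k : ℕ} {r : Req n Op}
    (hr : ρ.TOBCast D O t r) (hs : r.lvl = Level.strong) (hk : t < k) :
    (ρ.config D O k r.dot.1).awaiting r ≠ none ∨ ∃ m y, ρ.Answered D O t m y := by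
  refine config_induction (i := r.dot.1) (t₀ := t + 1)
    (P := fun _ σ => σ.awaiting r ≠ none ∨ ∃ m y, ρ.Answered D O t m y)
    ?_ (fun _ _ _ h _ => h) ?_ hk
  · obtain ⟨i, c, o, l, hev, -, rfl⟩ := tobCast_iff.1 hr
    obtain rfl : l = Level.strong := hs
    left
    rw [show (newRequest i (ρ.clock t) o Level.strong (ρ.config D O t i)).dot.1 = i from rfl,
      config_succ hev]
    simp [step, invokeStep_strong]
  · intro m ev hm ih hev
    rcases ih with ih | ih
    swap
    · exact Or.inr ih
    have h := inv hρ m r.dot.1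
    cases ev with
    | invoke c o l =>
      left
      cases l with
      | weak =>
        by_cases ho : o ∈ D.readonlyops
        · simpa only [step, invokeStep_readonly ho] using ih
        · simp only [step, invokeStep_weak ho]
          exact ih
      | strong =>
        simp only [step, invokeStep_strong, Function.update_apply]
        split_ifs
        · simp
        · exact ih
    | rbDeliver q =>
      left
      simp only [step, rbDeliverStep]
      split_ifs
      · exact ih
      · exact ih
    | tobDeliver q =>
      left
      simp only [step, h.commit_eq]
      exact ih
    | rollback =>
      left
      simp only [step, rollbackStep]
      split
      · exact ih
      · exact ih
    | execute =>
      obtain ⟨q, l, hl⟩ := List.exists_cons_of_ne_nil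
        (hρ.execution.execute_enabled m _ hev).2
      obtain ⟨f, -, hf, e⟩ := h.executeStep_eq O hl
      by_cases hqr : r = q
      · subst hqr
        obtain ⟨a, ha⟩ := Option.ne_none_iff_exists'.1 ih
        exact Or.inr ⟨m, _, Or.inr ⟨r, _, hr, hm, outcome_eq_some.2 ⟨_, _, hev, rfl⟩,
          by simp [step, e, ha]; rfl⟩⟩
      · left
        simp only [step, e, hf r hqr]
        exact ih

/-! ### Progress of the execution -/

theorem committed_prefix_committed {i : Fin n} {s t : ℕ} (h : s ≤ t) :
    (ρ.config D O s i).committed <+: (ρ.config D O t i).committed := by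
  refine config_induction (P := fun _ σ => (ρ.config D O s i).committed <+: σ.committed)
    (List.prefix_refl _) (fun _ _ _ h _ => h) (fun t ev _ h hev => h.trans ?_) h
  by_cases hd : ∃ r, ev = Event.tobDeliver r
  · obtain ⟨r, rfl⟩ := hd
    rw [step, committed_commit]
    exact List.prefix_append _ _
  · push Not at hd
    rw [committed_step hd]

/-- How the lists `executed` and `toBeRolledBack` change in a step. -/
theorem executed_step (hρ : ρ.IsStable D O lvlmap) (t : ℕ) (i : Fin n) :
    (ρ.event t ≠ some (i, Event.rollback) ∧ ρ.event t ≠ some (i, Event.execute) ∧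
      (((ρ.config D O (t + 1) i).executed = (ρ.config D O t i).executed ∧
        (ρ.config D O (t + 1) i).toBeRolledBack = (ρ.config D O t i).toBeRolledBack) ∨
      ((ρ.config D O (t + 1) i).executed =
        (adjustExecution (ρ.config D O t i) (ρ.config D O (t + 1) i).order).executed ∧
        (ρ.config D O (t + 1) i).toBeRolledBack =
        (adjustExecution (ρ.config D O t i)
          (ρ.config D O (t + 1) i).order).toBeRolledBack))) ∨
    (ρ.event t = some (i, Event.rollback) ∧
      (ρ.config D O (t + 1) i).executed = (ρ.config D O t i).executed ∧
      ∃ r, (ρ.config D O t i).toBeRolledBack =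
        r :: (ρ.config D O (t + 1) i).toBeRolledBack) ∨
    (ρ.event t = some (i, Event.execute) ∧
      (∃ r, (ρ.config D O (t + 1) i).executed = (ρ.config D O t i).executed ++ [r]) ∧
      (ρ.config D O (t + 1) i).toBeRolledBack = (ρ.config D O t i).toBeRolledBack) := by
  by_cases hev : ∀ ev, ρ.event t ≠ some (i, ev)
  · rw [config_succ_of_forall_ne hev]
    exact Or.inl ⟨hev _, hev _, Or.inl ⟨rfl, rfl⟩⟩
  push Not at hev
  obtain ⟨ev, hev⟩ := hev
  have h := inv hρ t i
  cases ev with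
  | invoke c o l =>
    refine Or.inl ⟨by simp [hev], by simp [hev], ?_⟩
    rw [config_succ hev]
    cases l with
    | weak =>
      by_cases ho : o ∈ D.readonlyops
      · exact Or.inl (by simp [step, invokeStep_readonly ho])
      · simp only [step, invokeStep_weak ho]
        exact Or.inr ⟨rfl, rfl⟩
    | strong => exact Or.inl ⟨rfl, rfl⟩
  | rbDeliver r =>
    refine Or.inl ⟨by simp [hev], by simp [hev], ?_⟩
    rw [config_succ hev]
    simp only [step, rbDeliverStep]
    split_ifs
    · exact Or.inl ⟨rfl, rfl⟩
    · exact Or.inr ⟨rfl, rfl⟩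
  | tobDeliver r =>
    refine Or.inl ⟨by simp [hev], by simp [hev], ?_⟩
    rw [config_succ hev]
    simp only [step, h.commit_eq]
    exact Or.inr ⟨rfl, rfl⟩
  | rollback =>
    refine Or.inr (Or.inl ⟨hev, ?_⟩)
    obtain ⟨r, l, hl⟩ := List.exists_cons_of_ne_nil (hρ.execution.rollback_enabled t i hev)
    rw [config_succ hev]
    simp [step, rollbackStep, hl]
  | execute =>
    refine Or.inr (Or.inr ⟨hev, ?_⟩)
    obtain ⟨r, l, hl⟩ := List.exists_cons_of_ne_nil
      (hρ.execution.execute_enabled t i hev).2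
    obtain ⟨f, -, -, e⟩ := h.executeStep_eq O hl
    rw [config_succ hev]
    simp [step, e]

theorem prefix_executed_succ (hρ : ρ.IsStable D O lvlmap) {t : ℕ} {i : Fin n}
    {C : List (Req n Op)} (hC : C <+: (ρ.config D O (t + 1) i).order)
    (h : C <+: (ρ.config D O t i).executed) : C <+: (ρ.config D O (t + 1) i).executed := by
  rcases executed_step hρ t i with ⟨-, -, ⟨e, -⟩ | ⟨e, -⟩⟩ | ⟨-, e, -⟩ | ⟨-, ⟨r, e⟩, -⟩
  · rwa [e]
  · rw [e]
    exact prefix_longestCommonPrefix h hC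
  · rwa [e]
  · rw [e]
    exact h.trans (List.prefix_append _ _)

/-- While `executed` is a part of the committed prefix `C`, nothing is scheduled for rollback and
nothing is taken away from `executed`. -/
theorem length_executed_succ (hρ : ρ.IsStable D O lvlmap) {t : ℕ} {i : Fin n}
    {C : List (Req n Op)} (hC : C <+: (ρ.config D O (t + 1) i).order)
    (h : (ρ.config D O t i).executed <+: C) :
    (ρ.config D O t i).executed.length ≤ (ρ.config D O (t + 1) i).executed.length ∧
    (ρ.config D O (t + 1) i).toBeRolledBack.length ≤ (ρ.config D O t i).toBeRolledBack.length ∧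
    (ρ.event t = some (i, Event.rollback) →
      (ρ.config D O (t + 1) i).toBeRolledBack.length <
        (ρ.config D O t i).toBeRolledBack.length) ∧
    (ρ.event t = some (i, Event.execute) →
      (ρ.config D O t i).executed.length < (ρ.config D O (t + 1) i).executed.length) := by
  rcases executed_step hρ t i with ⟨h1, h2, ⟨e, e'⟩ | ⟨e, e'⟩⟩ | ⟨h1, e, r, e'⟩ | ⟨h1, ⟨r, e⟩, e'⟩
  · simp [h1, h2, e, e']
  · have hp : longestCommonPrefix (ρ.config D O t i).executed
        (ρ.config D O (t + 1) i).order = (ρ.config D O t i).executed :=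
      (longestCommonPrefix_prefix_left _ _).eq_of_length_le
        (prefix_longestCommonPrefix (List.prefix_refl _) (h.trans hC)).length_le
    simp [h1, h2, e, e', adjustExecution, hp]
  · simp [h1, e, e']
  · simp [h1, e, e']

/-- Every committed prefix is eventually executed, and remains executed forever. -/
theorem eventually_prefix_executed (hρ : ρ.IsStable D O lvlmap) (i : Fin n) (t₀ : ℕ) :
    ∃ T, ∀ t, T ≤ t → (ρ.config D O t₀ i).committed <+: (ρ.config D O t i).executed := by
  set C := (ρ.config D O t₀ i).committed with hCdef
  have hC : ∀ t, t₀ ≤ t → C <+: (ρ.config D O t i).order := fun t ht =>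
    (committed_prefix_committed ht).trans (List.prefix_append _ _)
  suffices ∃ T, t₀ ≤ T ∧ C <+: (ρ.config D O T i).executed by
    obtain ⟨T, hT, h⟩ := this
    refine ⟨T, fun t ht => ?_⟩
    induction t, ht using Nat.le_induction with
    | base => exact h
    | succ t ht ih => exact prefix_executed_succ hρ (hC _ ((hT.trans ht).trans t.le_succ)) ih
  by_contra hne
  push Not at hne
  have hpre : ∀ t, t₀ ≤ t → (ρ.config D O t i).executed <+: C := fun t ht =>
    (List.prefix_or_prefix_of_prefix (inv hρ t i).executed_prefix (hC t ht)).resolve_right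
      (hne t ht)
  have hlen : ∀ t, t₀ ≤ t → (ρ.config D O t i).executed.length < C.length := by
    intro t ht
    refine lt_of_le_of_ne (hpre t ht).length_le fun e => hne t ht ?_
    rw [(hpre t ht).eq_of_length e]
  have hstep := fun t (ht : t₀ ≤ t) =>
    length_executed_succ hρ (hC (t + 1) (ht.trans t.le_succ)) (hpre t ht)
  have hmono : ∀ s t, t₀ ≤ s → s ≤ t →
      (ρ.config D O s i).executed.length ≤ (ρ.config D O t i).executed.length ∧
      (ρ.config D O t i).toBeRolledBack.length ≤ (ρ.config D O s i).toBeRolledBack.length := by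
    intro s t hs hst
    induction t, hst using Nat.le_induction with
    | base => exact ⟨le_rfl, le_rfl⟩
    | succ t ht ih =>
      have := hstep t (hs.trans ht)
      exact ⟨ih.1.trans this.1, this.2.1.trans ih.2⟩
  -- the number of missing executions and pending rollbacks decreases again and again
  have key : ∀ m t, t₀ ≤ t → C.length - (ρ.config D O t i).executed.length +
      (ρ.config D O t i).toBeRolledBack.length = m → False := by
    intro m
    induction m using Nat.strong_induction_on with
    | _ m ih =>
    intro t ht hm
    obtain ⟨t₁, ht₁, h₁⟩ := hρ.fair.execute i t
    have hl₁ := hlen t₁ (ht.trans ht₁)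
    have hm₁ := hmono t t₁ ht ht₁
    have hs₁ := hstep t₁ (ht.trans ht₁)
    rcases h₁ with h₁ | h₁
    · have := hs₁.2.2.2 h₁
      exact ih _ (by omega) (t₁ + 1) (by omega) rfl
    have hne₁ : (ρ.config D O t₁ i).toBeRolledBack ≠ [] := by
      intro hnil
      refine h₁ ⟨hnil, fun hnil' => ?_⟩
      have he := (inv hρ t₁ i).executed_append
      rw [hnil', List.append_nil] at he
      have := (hC t₁ (ht.trans ht₁)).length_le
      rw [← he] at this
      omega
    have hpos := List.length_pos_iff.2 hne₁
    obtain ⟨t₂, ht₂, h₂⟩ := hρ.fair.rollback i t₁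
    have hl₂ := hlen t₂ ((ht.trans ht₁).trans ht₂)
    have hm₂ := hmono t₁ t₂ (ht.trans ht₁) ht₂
    have hs₂ := hstep t₂ ((ht.trans ht₁).trans ht₂)
    rcases h₂ with h₂ | h₂
    · have := hs₂.2.2.1 h₂
      exact ih _ (by omega) (t₂ + 1) (by omega) rfl
    · rw [h₂, List.length_nil] at hm₂
      exact ih _ (by rw [h₂, List.length_nil]; omega) t₂ (by omega) rfl
  exact key _ t₀ le_rfl rfl

theorem exists_answered_strong (hρ : ρ.IsStable D O lvlmap) {t : ℕ} {r : Req n Op}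
    (hr : ρ.TOBCast D O t r) (hs : r.lvl = Level.strong) : ∃ k y, ρ.Answered D O t k y := by
  obtain ⟨s, hd⟩ := hρ.tob.delivery t r hr r.dot.1
  obtain ⟨T, hT⟩ := eventually_prefix_executed hρ r.dot.1 (s + 1)
  have hmem := (hT (max T (t + 1)) (le_max_left _ _)).subset
    (mem_committed.2 ⟨s, s.lt_succ_self, hd⟩)
  exact (awaiting_or_answered hρ hr hs (Nat.lt_of_lt_of_le t.lt_succ_self
    (le_max_right T (t + 1)))).resolve_left fun h => (inv hρ _ _).awaiting_executed r h hmem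

/-- From some instant on, the traces of all replicas begin with the requests which are committed
up to the instant `M`, in the commit order. -/
theorem eventually_trace (hρ : ρ.IsStable D O lvlmap) (M : ℕ) :
    ∃ T, ∀ t, T ≤ t → ∀ i : Fin n, ∃ β γ, (ρ.config D O t i).trace = β ++ γ ∧
      β.Pairwise (fun x y => ρ.firstDelivery x < ρ.firstDelivery y) ∧
      ∀ r, (∃ s, ρ.TOBCast D O s r) → ρ.firstDelivery r ≤ M → r ∈ β := by
  -- an instant by which replica `i` has delivered everything delivered anywhere up to `M`
  have hdel : ∀ i : Fin n, ∃ t₀, ∀ r, (∃ s, ρ.TOBCast D O s r) → ρ.firstDelivery r ≤ M →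
      r ∈ (ρ.config D O t₀ i).committed := by
    intro i
    have : ∀ m, ∃ t₀, ∀ r, (∃ s, ρ.TOBCast D O s r) → ρ.firstDelivery r = m →
        r ∈ (ρ.config D O t₀ i).committed := by
      intro m
      by_cases h : ∃ r, (∃ s, ρ.TOBCast D O s r) ∧ ρ.firstDelivery r = m
      · obtain ⟨r, ⟨s, hr⟩, rfl⟩ := h
        obtain ⟨k, hk⟩ := hρ.tob.delivery s r hr i
        refine ⟨k + 1, ?_⟩
        rintro q ⟨s', hq⟩ hqr
        rw [firstDelivery_inj hρ.tob hq hr hqr]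
        exact mem_committed.2 ⟨k, k.lt_succ_self, hk⟩
      · push Not at h
        exact ⟨0, fun r hr e => absurd e (h r hr)⟩
    choose f hf using this
    refine ⟨(Finset.range (M + 1)).sup f, fun r hr hM => ?_⟩
    exact (committed_prefix_committed (Finset.le_sup (f := f)
      (Finset.mem_range.2 (Nat.lt_succ_of_le hM)))).subset (hf _ r hr rfl)
  choose t₀ ht₀ using hdel
  choose T hT using fun i => eventually_prefix_executed hρ i (t₀ i)
  refine ⟨Finset.univ.sup T, fun t ht i => ?_⟩
  obtain ⟨l, hl⟩ := hT i t ((Finset.le_sup (Finset.mem_univ i)).trans ht)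
  exact ⟨_, l ++ (ρ.config D O t i).toBeRolledBack.reverse,
    by rw [ReplicaState.trace, ← hl, List.append_assoc], (inv hρ _ i).committed_sorted, ht₀ i⟩

end Run

/-! ### Operation contexts -/

theorem totalOrd_lt {A : Type*} [LinearOrder A] : TotalOrd (fun a b : A => a < b) :=
  ⟨⟨lt_irrefl, fun _ _ _ => lt_trans⟩, fun _ _ h => lt_or_gt_of_ne h⟩

/-- Enlarging a context by read-only operations does not change the value of any operation. -/
theorem ReplicatedDataType.F_eq_of_embedding {Op : Type u} {Val : Type v}
    (D : ReplicatedDataType Op Val) (o : Op) (B C : OpContext Op) (f : B.E → C.E)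
    (hf : Function.Injective f) (hro : ∀ e, (∀ b, f b ≠ e) → C.op e ∈ D.readonlyops)
    (hop : ∀ b, C.op (f b) = B.op b) (hvis : ∀ a b, C.vis (f a) (f b) ↔ B.vis a b)
    (har : ∀ a b, C.ar (f a) (f b) ↔ B.ar a b) : D.F o C = D.F o B := by
  induction hm : Nat.card C.E using Nat.strong_induction_on generalizing C with
  | _ m ih =>
  by_cases hs : Function.Surjective f
  · exact (D.iso_invariant o B C ⟨Equiv.ofBijective f ⟨hf, hs⟩, fun b => (hop b).symm,
      fun a b => (hvis a b).symm, fun a b => (har a b).symm⟩).symm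
  · unfold Function.Surjective at hs
    push Not at hs
    obtain ⟨e, he⟩ := hs
    have := C.finite
    rw [hro e he o C e rfl]
    exact ih _ (hm ▸ Finite.card_subtype_lt (not_not.2 rfl)) (C.erase e) (fun b => ⟨f b, he b⟩)
      (fun a b hab => hf (congrArg Subtype.val hab))
      (fun (a : {a : C.E // a ≠ e}) ha => hro a fun b hb => ha b (Subtype.ext hb)) hop hvis har rfl

namespace Run

variable {n : ℕ} {Op : Type u} {Val : Type v} {Client : Type x} {ρ : Run n Op Client}
  {D : ReplicatedDataType Op Val} {O : StateObject.{u, v, w} n Op Val}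
  {lvlmap : Op → Set Level}

/-! ### The history of a stable run -/

theorem Answered.le {t k : ℕ} {y : Val} (h : ρ.Answered D O t k y) : t ≤ k := by
  rcases h with ⟨_, _, _, rfl⟩ | ⟨_, _, _, h, _⟩
  · exact le_rfl
  · exact h.le

theorem lt_of_rb {a b : (ρ.history D O).E} (h : (ρ.history D O).rb a b) : a.1 < b.1 := by
  obtain ⟨k, y, hk, hb⟩ := h
  exact hk.le.trans_lt hb

theorem rval_eq {e : (ρ.history D O).E} {y : Val} (h : ∃ k z, ρ.Answered D O e.1 k z)
    (hy : ∀ k z, ρ.Answered D O e.1 k z → z = y) : (ρ.history D O).rval e = some y := by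
  classical
  have h' : (ρ.history D O).rval e = if h : ∃ k v, ρ.Answered D O e.1 k v then
    some (Nat.find_spec h).choose else none := rfl
  rw [h', dif_pos h]
  exact congrArg some (hy _ _ (Nat.find_spec h).choose_spec)

theorem event_eq (e : (ρ.history D O).E) : ∃ i c, ρ.event e.1 =
    some (i, Event.invoke c ((ρ.history D O).op e) ((ρ.history D O).lvl e)) := by
  have key : ∀ (t : ℕ) (p : Client × Op × Level), ρ.invocation t = some p →
      ∃ i, ρ.event t = some (i, Event.invoke p.1 p.2.1 p.2.2) := by
    intro t p hp
    unfold invocation at hp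
    split at hp
    · obtain rfl := Option.some.inj hp
      exact ⟨_, by assumption⟩
    · simp at hp
  obtain ⟨i, hi⟩ := key e.1 _ (Option.some_get e.2).symm
  exact ⟨i, _, hi⟩

theorem TOBCast.invocation {t : ℕ} {r : Req n Op} (h : ρ.TOBCast D O t r) :
    (ρ.invocation t).isSome := by
  obtain ⟨i, c, o, l, hev, -, -⟩ := tobCast_iff.1 h
  simp [Run.invocation, hev]

theorem TOBCast.op_lvl {e : (ρ.history D O).E} {r : Req n Op} (h : ρ.TOBCast D O e.1 r) :
    (ρ.history D O).op e = r.op ∧ (ρ.history D O).lvl e = r.lvl := by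
  obtain ⟨i, c, o, l, hev, -, rfl⟩ := tobCast_iff.1 h
  obtain ⟨j, c', hev'⟩ := event_eq e
  rw [hev] at hev'
  simp only [Option.some.injEq, Prod.mk.injEq, Event.invoke.injEq] at hev'
  exact ⟨hev'.2.2.1.symm, hev'.2.2.2.symm⟩

/-- The invocations at which nothing is broadcast are those of weak read-only operations. -/
theorem readonly_of_forall_not_tobCast {e : (ρ.history D O).E}
    (h : ∀ r, ¬ ρ.TOBCast D O e.1 r) :
    (ρ.history D O).lvl e = Level.weak ∧ (ρ.history D O).op e ∈ D.readonlyops := by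
  obtain ⟨i, c, hev⟩ := event_eq e
  by_contra hne
  exact h _ (tobCast_iff.2 ⟨i, c, _, _, hev, fun hw ho => hne ⟨hw, ho⟩, rfl⟩)

theorem exists_tobCast_of_strong {e : (ρ.history D O).E}
    (h : (ρ.history D O).lvl e = Level.strong) :
    ∃ r, ρ.TOBCast D O e.1 r ∧ r.lvl = Level.strong := by
  by_contra hne
  push Not at hne
  have := (readonly_of_forall_not_tobCast fun r hr => hne r hr (hr.op_lvl.2 ▸ h)).1
  rw [h] at this
  simp at this

theorem history_wellFormed (hρ : ρ.IsStable D O lvlmap) : (ρ.history D O).WellFormed where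
  countable := inferInstanceAs (Countable {t : ℕ // (ρ.invocation t).isSome})
  rb_order := ⟨fun a h => lt_irrefl _ (lt_of_rb h), fun a b c hab hbc => by
    obtain ⟨k, y, hk, hkb⟩ := hab
    exact ⟨k, y, hk, hkb.trans (lt_of_rb hbc)⟩⟩
  rb_natural b := ((Set.finite_lt_nat b.1).preimage Subtype.val_injective.injOn).subset
    fun a ha => lt_of_rb ha
  ss_equiv := ⟨fun _ => rfl, fun h => Eq.symm h, fun h h' => Eq.trans h h'⟩
  pending a b h := by
    classical
    obtain ⟨k, y, hk, -⟩ := h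
    have h' : (ρ.history D O).rval a = if h : ∃ k v, ρ.Answered D O a.1 k v then
      some (Nat.find_spec h).choose else none := rfl
    rw [h', dif_pos ⟨k, y, hk⟩]
    simp
  interval a b c d hab hcd := by
    obtain ⟨k, y, hk, hkb⟩ := hab
    obtain ⟨m, z, hm, hmd⟩ := hcd
    rcases le_total k m with h | h
    · exact Or.inl ⟨k, y, hk, h.trans_lt hmd⟩
    · exact Or.inr ⟨m, z, hm, h.trans_lt hkb⟩
  session e := by
    refine ⟨⟨⟨fun a h => lt_irrefl _ (lt_of_rb h), fun a b c hab hbc => ?_⟩, ?_⟩, fun b => ?_⟩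
    · obtain ⟨k, y, hk, hkb⟩ := hab
      exact ⟨k, y, hk, hkb.trans (lt_of_rb hbc)⟩
    · have key : ∀ a b : (ρ.history D O).E, (ρ.history D O).ss e a → (ρ.history D O).ss e b →
          a.1 < b.1 → (ρ.history D O).rb a b := fun a b ha hb hlt =>
        hρ.execution.sequential a.1 b.1 _ ((ρ.invocation a.1).get a.2).2
          ((ρ.invocation b.1).get b.2).2 hlt (Option.some_get a.2).symm
          (((Option.some_get b.2).symm).trans
            (congrArg some (Prod.ext (hb.symm.trans ha) rfl)))
      intro a b hab
      have : a.1.1 ≠ b.1.1 := fun h => hab (Subtype.ext (Subtype.ext h))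
      rcases lt_or_gt_of_ne this with h | h
      · exact Or.inl (key _ _ a.2 b.2 h)
      · exact Or.inr (key _ _ b.2 a.2 h)
    · exact ((Set.finite_lt_nat b.1.1).preimage
        (f := fun a : {a : (ρ.history D O).E // (ρ.history D O).ss e a} => a.1.1)
        (fun a _ c _ h => Subtype.ext (Subtype.ext h))).subset fun a ha => lt_of_rb ha

/-! ### The abstract execution -/

variable (ρ D O)

open Classical in
/-- The instant at which an invocation takes effect in the arbitration order: its own instant for
a weak read-only operation, and the first delivery of its request otherwise. -/
noncomputable def arKey (t : ℕ) : ℕ :=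
  if h : ∃ r, ρ.TOBCast D O t r then ρ.firstDelivery h.choose else t

/-- The trace of the invoking replica just before instant `t`. -/
noncomputable def traceAt (t : ℕ) : List (Req n Op) :=
  match ρ.event t with
  | some (i, _) => (ρ.config D O t i).trace
  | none => []

open Classical in
/-- The position of an invocation in the order given by the list `α`: for a request the latest
first delivery of a request up to it in `α`, which is its own if `α` follows the commit order so
far. -/
noncomputable def parKey (α : List (Req n Op)) (t : ℕ) : ℕ :=
  if h : ∃ r, ρ.TOBCast D O t r then
    (α.take (α.idxOf h.choose + 1)).toFinset.sup ρ.firstDelivery else t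

open Classical in
/-- Separates the requests in `α` for which `parKey` is the same. -/
noncomputable def parIdx (α : List (Req n Op)) (t : ℕ) : ℕ :=
  if h : ∃ r, ρ.TOBCast D O t r then α.idxOf h.choose else 0

/-- The perceived arbitration of an invocation in the trace `α`: requests come in the order of
`α`, and read-only operations are interleaved as in the arbitration order. -/
def Perceived (α : List (Req n Op)) (s t : ℕ) : Prop :=
  toLex (ρ.parKey D O α s, toLex (ρ.parIdx D O α s, ρ.arKey D O s)) <
    toLex (ρ.parKey D O α t, toLex (ρ.parIdx D O α t, ρ.arKey D O t))

/-- Visibility. Strong operations see everything arbitrated before them; weak operations see the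
requests in the trace of the replica and all earlier weak read-only operations. -/
def Sees (a b : (ρ.history D O).E) : Prop :=
  match (ρ.history D O).lvl b with
  | Level.strong => ρ.arKey D O a.1 < ρ.arKey D O b.1
  | Level.weak => ((∀ r, ¬ ρ.TOBCast D O a.1 r) ∧ a.1 < b.1) ∨
      ∃ r, ρ.TOBCast D O a.1 r ∧ r ∈ ρ.traceAt D O b.1

variable {ρ D O}

theorem TOBCast.arKey_eq {t : ℕ} {r : Req n Op} (h : ρ.TOBCast D O t r) :
    ρ.arKey D O t = ρ.firstDelivery r := by
  have h' : ∃ r, ρ.TOBCast D O t r := ⟨r, h⟩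
  rw [arKey, dif_pos h', h'.choose_spec.inj_right h]

theorem arKey_of_forall_not {t : ℕ} (h : ∀ r, ¬ ρ.TOBCast D O t r) : ρ.arKey D O t = t :=
  dif_neg fun ⟨r, hr⟩ => h r hr

open Classical in
theorem TOBCast.parKey_eq {t : ℕ} {r : Req n Op} (h : ρ.TOBCast D O t r) (α : List (Req n Op)) :
    ρ.parKey D O α t = (α.take (α.idxOf r + 1)).toFinset.sup ρ.firstDelivery := by
  have h' : ∃ r, ρ.TOBCast D O t r := ⟨r, h⟩
  rw [parKey, dif_pos h', h'.choose_spec.inj_right h]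

theorem parKey_of_forall_not {t : ℕ} (h : ∀ r, ¬ ρ.TOBCast D O t r) (α : List (Req n Op)) :
    ρ.parKey D O α t = t :=
  dif_neg fun ⟨r, hr⟩ => h r hr

open Classical in
theorem TOBCast.parIdx_eq {t : ℕ} {r : Req n Op} (h : ρ.TOBCast D O t r) (α : List (Req n Op)) :
    ρ.parIdx D O α t = α.idxOf r := by
  have h' : ∃ r, ρ.TOBCast D O t r := ⟨r, h⟩
  rw [parIdx, dif_pos h', h'.choose_spec.inj_right h]

theorem sees_strong {a b : (ρ.history D O).E} (h : (ρ.history D O).lvl b = Level.strong) :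
    ρ.Sees D O a b ↔ ρ.arKey D O a.1 < ρ.arKey D O b.1 := by
  simp [Sees, h]

theorem sees_weak {a b : (ρ.history D O).E} (h : (ρ.history D O).lvl b = Level.weak) :
    ρ.Sees D O a b ↔ ((∀ r, ¬ ρ.TOBCast D O a.1 r) ∧ a.1 < b.1) ∨
      ∃ r, ρ.TOBCast D O a.1 r ∧ r ∈ ρ.traceAt D O b.1 := by
  simp [Sees, h]

theorem sees_weak_of_tobCast {a b : (ρ.history D O).E} {r : Req n Op}
    (h : (ρ.history D O).lvl b = Level.weak) (hr : ρ.TOBCast D O a.1 r) :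
    ρ.Sees D O a b ↔ r ∈ ρ.traceAt D O b.1 := by
  rw [sees_weak h]
  constructor
  · rintro (⟨h, -⟩ | ⟨q, hq, hm⟩)
    · exact absurd hr (h r)
    · exact hr.inj_right hq ▸ hm
  · exact fun hm => Or.inr ⟨r, hr, hm⟩

theorem traceAt_eq {t : ℕ} {i : Fin n} {ev : Event n Op Client} (h : ρ.event t = some (i, ev)) :
    ρ.traceAt D O t = (ρ.config D O t i).trace := by
  simp [traceAt, h]

theorem arKey_injective (hρ : ρ.IsStable D O lvlmap) :
    Function.Injective fun e : (ρ.history D O).E => ρ.arKey D O e.1 := by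
  -- an instant is not both that of an invocation and that of a delivery
  have hne : ∀ (e : (ρ.history D O).E) (t : ℕ) (r : Req n Op), ρ.TOBCast D O t r →
      e.1 ≠ ρ.firstDelivery r := by
    intro e t r hr he
    obtain ⟨i, c, hev⟩ := event_eq e
    obtain ⟨j, hj⟩ := exists_tobDelivers_firstDelivery hρ.tob hr
    unfold TOBDelivers at hj
    rw [← he, hev] at hj
    simp at hj
  intro a b hab
  apply Subtype.ext
  dsimp only at hab
  by_cases ha : ∃ r, ρ.TOBCast D O a.1 r <;> by_cases hb : ∃ r, ρ.TOBCast D O b.1 r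
  · obtain ⟨r, hr⟩ := ha
    obtain ⟨q, hq⟩ := hb
    rw [hr.arKey_eq, hq.arKey_eq] at hab
    exact hr.inj_left (firstDelivery_inj hρ.tob hr hq hab ▸ hq)
  · obtain ⟨r, hr⟩ := ha
    rw [hr.arKey_eq, arKey_of_forall_not (not_exists.1 hb)] at hab
    exact absurd hab.symm (hne b _ r hr)
  · obtain ⟨r, hr⟩ := hb
    rw [hr.arKey_eq, arKey_of_forall_not (not_exists.1 ha)] at hab
    exact absurd hab (hne a _ r hr)
  · rwa [arKey_of_forall_not (not_exists.1 ha), arKey_of_forall_not (not_exists.1 hb)] at hab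

theorem le_arKey (hρ : ρ.IsStable D O lvlmap) (t : ℕ) : t ≤ ρ.arKey D O t := by
  by_cases h : ∃ r, ρ.TOBCast D O t r
  · obtain ⟨r, hr⟩ := h
    rw [hr.arKey_eq]
    exact (lt_firstDelivery hρ.tob hr).le
  · rw [arKey_of_forall_not (not_exists.1 h)]

theorem finite_arKey_le (hρ : ρ.IsStable D O lvlmap) (M : ℕ) :
    {e : (ρ.history D O).E | ρ.arKey D O e.1 ≤ M}.Finite :=
  (Set.finite_Iic M).preimage (arKey_injective hρ).injOn

/-- The instant at which an operation takes effect in the causal order: weak operations do so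
when they are invoked, strong ones when they are first delivered. -/
noncomputable def effect (e : (ρ.history D O).E) : ℕ :=
  match (ρ.history D O).lvl e with
  | Level.strong => ρ.arKey D O e.1
  | Level.weak => e.1

theorem effect_strong {e : (ρ.history D O).E} (h : (ρ.history D O).lvl e = Level.strong) :
    effect e = ρ.arKey D O e.1 := by
  simp [effect, h]

theorem effect_weak {e : (ρ.history D O).E} (h : (ρ.history D O).lvl e = Level.weak) :
    effect e = e.1 := by
  simp [effect, h]

theorem le_effect (hρ : ρ.IsStable D O lvlmap) (e : (ρ.history D O).E) : e.1 ≤ effect e := by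
  rcases h : (ρ.history D O).lvl e with _ | _
  · rw [effect_weak h]
  · rw [effect_strong h]
    exact le_arKey hρ _

theorem effect_le_arKey (hρ : ρ.IsStable D O lvlmap) (e : (ρ.history D O).E) :
    effect e ≤ ρ.arKey D O e.1 := by
  rcases h : (ρ.history D O).lvl e with _ | _
  · rw [effect_weak h]
    exact le_arKey hρ _
  · rw [effect_strong h]

theorem effect_lt_of_answered (hρ : ρ.IsStable D O lvlmap) (hO : O.Implements D)
    {a : (ρ.history D O).E} {k t : ℕ} {y : Val} (h : ρ.Answered D O a.1 k y) (ht : k < t) :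
    effect a < t := by
  rcases hl : (ρ.history D O).lvl a with _ | _
  · rw [effect_weak hl]
    exact h.le.trans_lt ht
  · obtain ⟨r, hr, hs⟩ := exists_tobCast_of_strong hl
    rw [effect_strong hl, hr.arKey_eq]
    exact (answered_strong hρ hO hr hs h).1.trans ht

theorem effect_lt_of_rb (hρ : ρ.IsStable D O lvlmap) (hO : O.Implements D)
    {a b : (ρ.history D O).E} (h : (ρ.history D O).rb a b) : effect a < effect b := by
  obtain ⟨k, y, hk, hb⟩ := h
  exact (effect_lt_of_answered hρ hO hk hb).trans_le (le_effect hρ b)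

theorem effect_lt_of_sees (hρ : ρ.IsStable D O lvlmap)
    {a b : (ρ.history D O).E} (h : ρ.Sees D O a b) : effect a < effect b := by
  rcases hl : (ρ.history D O).lvl b with _ | _
  · rw [effect_weak hl]
    rcases (sees_weak hl).1 h with ⟨hr, hlt⟩ | ⟨r, hr, hm⟩
    · rwa [effect_weak (readonly_of_forall_not_tobCast hr).1]
    · obtain ⟨i, c, hev⟩ := event_eq b
      rw [traceAt_eq hev] at hm
      obtain ⟨h1, h2⟩ := lt_of_mem_trace hρ hr hm
      rcases ha : (ρ.history D O).lvl a with _ | _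
      · rwa [effect_weak ha]
      · rw [effect_strong ha, hr.arKey_eq]
        exact h2 (hr.op_lvl.2 ▸ ha)
  · rw [effect_strong hl]
    exact (effect_le_arKey hρ a).trans_lt ((sees_strong hl).1 h)

theorem finite_sees (hρ : ρ.IsStable D O lvlmap) (b : (ρ.history D O).E) :
    {a | ρ.Sees D O a b}.Finite := by
  refine ((Set.finite_lt_nat (effect b)).preimage
    (Subtype.val_injective (p := fun t => (ρ.invocation t).isSome)).injOn).subset fun a ha => ?_
  exact (le_effect hρ a).trans_lt (effect_lt_of_sees hρ ha)

/-- Arbitration by `arKey`, visibility by `Sees`, perceived arbitration by the trace of the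
replica. -/
def abstractExecution (hρ : ρ.IsStable D O lvlmap) :
    AbstractExecution (ρ.history D O) where
  wellFormed := history_wellFormed hρ
  vis := ρ.Sees D O
  ar a b := ρ.arKey D O a.1 < ρ.arKey D O b.1
  par e a b := ρ.Perceived D O (ρ.traceAt D O e.1) a.1 b.1
  vis_acyclic := Acyclic.of_lt effect fun _ _ h => effect_lt_of_sees hρ h
  vis_natural := finite_sees hρ
  ar_total := totalOrd_lt.comap (arKey_injective hρ)
  par_total e := totalOrd_lt.comap (f := fun a : (ρ.history D O).E =>
      toLex (ρ.parKey D O (ρ.traceAt D O e.1) a.1,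
        toLex (ρ.parIdx D O (ρ.traceAt D O e.1) a.1, ρ.arKey D O a.1))) fun a b hab => by
    simp only [EmbeddingLike.apply_eq_iff_eq, Prod.mk.injEq] at hab
    exact arKey_injective hρ hab.2.2

theorem abstractExecution_NCC (hρ : ρ.IsStable D O lvlmap) (hO : O.Implements D) (l : Level) :
    (abstractExecution hρ).NCC l := by
  refine Acyclic.of_lt effect ?_
  rintro a b ⟨h, -⟩
  induction h with
  | single h => exact h.elim (fun h => effect_lt_of_rb hρ hO h.1) (effect_lt_of_sees hρ)
  | tail _ h ih =>
    exact ih.trans (h.elim (fun h => effect_lt_of_rb hρ hO h.1) (effect_lt_of_sees hρ))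

theorem abstractExecution_EV_strong (hρ : ρ.IsStable D O lvlmap) :
    (abstractExecution hρ).EV Level.strong := by
  intro e
  refine (finite_arKey_le hρ (ρ.arKey D O e.1)).subset ?_
  rintro b ⟨hb, -, hv⟩
  exact not_lt.1 fun h => hv ((sees_strong hb).2 h)

theorem finite_of_forall_ge {P : (ρ.history D O).E → Prop} (T : ℕ)
    (h : ∀ e, T ≤ e.1 → ¬ P e) : {e | P e}.Finite :=
  ((Set.finite_lt_nat T).preimage
    (Subtype.val_injective (p := fun t => (ρ.invocation t).isSome)).injOn).subset
    fun e he => not_le.1 fun hT => h e hT he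

theorem abstractExecution_EV_weak (hρ : ρ.IsStable D O lvlmap) :
    (abstractExecution hρ).EV Level.weak := by
  intro e
  by_cases hc : ∃ r, ρ.TOBCast D O e.1 r
  · obtain ⟨r, hr⟩ := hc
    obtain ⟨T, hT⟩ := eventually_trace hρ (ρ.firstDelivery r)
    refine finite_of_forall_ge T ?_
    rintro b hb ⟨hl, -, hv⟩
    obtain ⟨i, c, hev⟩ := event_eq b
    obtain ⟨β, γ, htr, -, hm⟩ := hT b.1 hb i
    refine hv ((sees_weak_of_tobCast hl hr).2 ?_)
    rw [traceAt_eq hev, htr]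
    exact List.mem_append_left _ (hm r ⟨_, hr⟩ le_rfl)
  · refine Set.Finite.subset Set.finite_empty ?_
    rintro b ⟨hl, hrb, hv⟩
    exact hv ((sees_weak hl).2 (Or.inl ⟨not_exists.1 hc, lt_of_rb hrb⟩))

theorem abstractExecution_SinOrd (hρ : ρ.IsStable D O lvlmap) :
    (abstractExecution hρ).SinOrd Level.strong :=
  ⟨∅, by simp, fun a b hb => (sees_strong hb).trans (by simp [abstractExecution])⟩

theorem abstractExecution_RT (hρ : ρ.IsStable D O lvlmap) (hO : O.Implements D) :
    (abstractExecution hρ).RT Level.strong := by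
  intro a b ha hb h
  have := effect_lt_of_rb hρ hO h
  rwa [effect_strong ha, effect_strong hb] at this

/-! ### Convergence of the perceived arbitration -/

theorem arKey_le_parKey {α : List (Req n Op)} {t : ℕ}
    (h : ∀ r, ρ.TOBCast D O t r → r ∈ α) : ρ.arKey D O t ≤ ρ.parKey D O α t := by
  classical
  by_cases hc : ∃ r, ρ.TOBCast D O t r
  · obtain ⟨r, hr⟩ := hc
    rw [hr.arKey_eq, hr.parKey_eq]
    refine Finset.le_sup (f := ρ.firstDelivery) ?_
    rw [List.mem_toFinset, List.mem_take_iff_getElem]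
    have := List.idxOf_lt_length_of_mem (h r hr)
    exact ⟨α.idxOf r, by omega, by simp⟩
  · rw [arKey_of_forall_not (not_exists.1 hc), parKey_of_forall_not (not_exists.1 hc)]

theorem parKey_eq_arKey {β γ : List (Req n Op)} {t : ℕ}
    (hβ : β.Pairwise (fun x y => ρ.firstDelivery x < ρ.firstDelivery y))
    (h : ∀ r, ρ.TOBCast D O t r → r ∈ β) : ρ.parKey D O (β ++ γ) t = ρ.arKey D O t := by
  classical
  refine le_antisymm ?_ (arKey_le_parKey fun r hr => List.mem_append_left _ (h r hr))
  by_cases hc : ∃ r, ρ.TOBCast D O t r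
  · obtain ⟨r, hr⟩ := hc
    rw [hr.arKey_eq, hr.parKey_eq]
    refine Finset.sup_le fun x hx => ?_
    have hlt := List.idxOf_lt_length_of_mem (h r hr)
    rw [List.mem_toFinset, List.idxOf_append_of_mem (h r hr),
      List.take_append_of_le_length hlt, List.mem_take_iff_getElem] at hx
    obtain ⟨j, hj, rfl⟩ := hx
    have hj' : j ≤ β.idxOf r := by omega
    rcases hj'.lt_or_eq with hj' | rfl
    · have := List.pairwise_iff_getElem.1 hβ j (β.idxOf r) (by omega) hlt hj'
      rw [List.getElem_idxOf] at this
      exact this.le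
    · rw [List.getElem_idxOf]
  · rw [arKey_of_forall_not (not_exists.1 hc), parKey_of_forall_not (not_exists.1 hc)]

theorem abstractExecution_CPar (hρ : ρ.IsStable D O lvlmap) :
    (abstractExecution hρ).CPar Level.weak := by
  intro e
  obtain ⟨T, hT⟩ := eventually_trace hρ (ρ.arKey D O e.1)
  refine finite_of_forall_ge T ?_
  rintro b hb ⟨hl, -, hne⟩
  obtain ⟨i, c, hev⟩ := event_eq b
  obtain ⟨β, γ, htr, hβ, hm⟩ := hT b.1 hb i
  have htr' : ρ.traceAt D O b.1 = β ++ γ := (traceAt_eq hev).trans htr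
  have heq : ∀ a : (ρ.history D O).E, ρ.arKey D O a.1 ≤ ρ.arKey D O e.1 →
      ρ.parKey D O (β ++ γ) a.1 = ρ.arKey D O a.1 := fun a ha =>
    parKey_eq_arKey hβ fun r hr => hm r ⟨_, hr⟩ (hr.arKey_eq ▸ ha)
  refine hne (congrArg Set.encard (Set.ext fun a => and_congr_right fun hv => ?_))
  change ρ.Perceived D O (ρ.traceAt D O b.1) a.1 e.1 ↔ ρ.arKey D O a.1 < ρ.arKey D O e.1
  rw [htr', Perceived, Prod.Lex.toLex_lt_toLex, heq e le_rfl]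
  rcases lt_trichotomy (ρ.arKey D O a.1) (ρ.arKey D O e.1) with h | h | h
  · simp [heq a h.le, h]
  · obtain rfl := arKey_injective hρ h
    simp [heq a le_rfl]
  · have hle : ρ.arKey D O a.1 ≤ ρ.parKey D O (β ++ γ) a.1 := arKey_le_parKey fun r hr => by
      rw [← htr']
      exact (sees_weak_of_tobCast hl hr).1 hv
    have := h.trans_le hle
    simp [this.not_gt, this.ne', h.not_gt]

/-! ### Return values -/

theorem traceVis_iff_sees (hρ : ρ.IsStable D O lvlmap) {α : List (Req n Op)}
    {a b : (ρ.history D O).E} {i j : Fin α.length} (ha : ρ.TOBCast D O a.1 (α.get i))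
    (hb : ρ.TOBCast D O b.1 (α.get j))
    (hα : α.Pairwise (fun x y => x.lvl = Level.strong ∨ y.lvl = Level.strong →
      ρ.firstDelivery x < ρ.firstDelivery y)) :
    ρ.Sees D O a b ↔ traceVis α i j := by
  unfold traceVis
  have hlb := hb.op_lvl.2
  rcases hl : (α.get j).lvl with _ | _
  · rw [hl] at hlb
    obtain ⟨k, c, o, l, hev, -, hq⟩ := tobCast_iff.1 hb
    rw [sees_weak_of_tobCast hlb ha, traceAt_eq hev]
    exact (mem_ctx_iff hρ ha hq).symm
  · rw [hl] at hlb
    rw [sees_strong hlb, ha.arKey_eq, hb.arKey_eq]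
    rw [List.pairwise_iff_get] at hα
    constructor
    · intro h
      rcases lt_trichotomy i j with hij | rfl | hij
      · exact hij
      · exact absurd h (lt_irrefl _)
      · exact absurd h (hα j i hij (Or.inl hl)).asymm
    · exact fun hij => hα i j hij (Or.inr hl)

theorem perceived_iff {α : List (Req n Op)} (hnd : α.Nodup) {s t : ℕ} {i j : Fin α.length}
    (hs : ρ.TOBCast D O s (α.get i)) (ht : ρ.TOBCast D O t (α.get j)) :
    ρ.Perceived D O α s t ↔ i < j := by
  classical
  have key : ∀ {s t : ℕ} {i j : Fin α.length}, ρ.TOBCast D O s (α.get i) →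
      ρ.TOBCast D O t (α.get j) → i < j → ρ.Perceived D O α s t := by
    intro s t i j hs ht hij
    rw [Perceived, Prod.Lex.toLex_lt_toLex, Prod.Lex.toLex_lt_toLex, hs.parKey_eq, ht.parKey_eq,
      hs.parIdx_eq, ht.parIdx_eq]
    have hi : α.idxOf (α.get i) = i := by simp [hnd.idxOf_getElem]
    have hj : α.idxOf (α.get j) = j := by simp [hnd.idxOf_getElem]
    rw [hi, hj]
    have hle : (α.take (i.1 + 1)).toFinset.sup ρ.firstDelivery ≤
        (α.take (j.1 + 1)).toFinset.sup ρ.firstDelivery :=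
      Finset.sup_mono fun x hx => List.mem_toFinset.2
        (List.take_subset_take_left α (by have : i.1 < j.1 := hij; omega)
          (List.mem_toFinset.1 hx))
    rcases hle.lt_or_eq with h | h
    · exact Or.inl h
    · exact Or.inr ⟨h, Or.inl hij⟩
  refine ⟨fun h => ?_, key hs ht⟩
  rcases lt_trichotomy i j with hij | rfl | hij
  · exact hij
  · obtain rfl := hs.inj_left ht
    exact absurd h (lt_irrefl _)
  · exact absurd h (lt_asymm (key ht hs hij))

/-- A context whose events are the requests of a trace, in the order of the trace, together with
some weak read-only operations yields the same values as the trace. -/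
theorem F_eq_F_traceContext (hρ : ρ.IsStable D O lvlmap) (o : Op) {α : List (Req n Op)}
    (hα : ValidTrace α)
    (hs : α.Pairwise (fun x y => x.lvl = Level.strong ∨ y.lvl = Level.strong →
      ρ.firstDelivery x < ρ.firstDelivery y))
    (hK : ∀ r ∈ α, ∃ s, ρ.TOBCast D O s r) (C : OpContext Op)
    (g : C.E → (ρ.history D O).E) (hg : Function.Injective g)
    (hg' : ∀ a r, ρ.TOBCast D O a.1 r → (r ∈ α ↔ a ∈ Set.range g))
    (hop : ∀ e, C.op e = (ρ.history D O).op (g e))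
    (hvis : ∀ a b, C.vis a b ↔ ρ.Sees D O (g a) (g b))
    (har : ∀ (a b : C.E) (i j : Fin α.length), ρ.TOBCast D O (g a).1 (α.get i) →
      ρ.TOBCast D O (g b).1 (α.get j) → (C.ar a b ↔ i < j)) :
    D.F o C = D.F o (traceContext α hα) := by
  have hex : ∀ i : Fin α.length, ∃ e, ρ.TOBCast D O (g e).1 (α.get i) := by
    intro i
    have hm := List.get_mem α i
    obtain ⟨s, hcast⟩ := hK _ hm
    obtain ⟨e, he⟩ := (hg' ⟨s, hcast.invocation⟩ _ hcast).1 hm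
    exact ⟨e, by rw [he]; exact hcast⟩
  choose f hf using hex
  refine D.F_eq_of_embedding o (traceContext α hα) C f ?_ ?_ ?_ ?_ ?_
  · intro i j hij
    have := hf i
    rw [hij] at this
    exact hα.1.injective_get (this.inj_right (hf j))
  · intro e he
    rw [hop]
    refine (readonly_of_forall_not_tobCast fun r hr => ?_).2
    obtain ⟨i, rfl⟩ := List.get_of_mem ((hg' _ r hr).2 ⟨e, rfl⟩)
    exact he i (hg (Subtype.ext ((hf i).inj_left hr)))
  · intro i
    rw [hop, (hf i).op_lvl.1]
    rfl
  · intro i j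
    rw [hvis]
    exact traceVis_iff_sees hρ (hf i) (hf j) hs
  · exact fun i j => har _ _ i j (hf i) (hf j)

theorem mem_range_val_sees (a e : (ρ.history D O).E) :
    a ∈ Set.range (Subtype.val : {a // ρ.Sees D O a e} → (ρ.history D O).E) ↔
      ρ.Sees D O a e := by
  simp

theorem abstractExecution_FRVal (hρ : ρ.IsStable D O lvlmap) (hO : O.Implements D) :
    (abstractExecution hρ).FRVal Level.weak D := by
  intro e hl
  obtain ⟨i, c, hev⟩ := event_eq e
  have hans := fun k y => answered_weak_iff hρ hO (k := k) (y := y) (hl ▸ hev)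
  have h := inv hρ e.1 i
  refine rval_eq ⟨_, _, (hans _ _).2 ⟨rfl, rfl⟩⟩ fun k z hk => ((hans k z).1 hk).2.trans ?_
  refine (F_eq_F_traceContext hρ _ _ h.trace_sorted
    (fun r hr => let ⟨s, _, hs⟩ := h.trace_known r hr; ⟨s, hs⟩) _ Subtype.val
    Subtype.val_injective ?_ (fun _ => rfl) (fun _ _ => Iff.rfl) ?_).symm
  · intro a r hr
    refine Iff.trans ?_ (mem_range_val_sees a e).symm
    rw [sees_weak_of_tobCast hl hr, traceAt_eq hev]
  · intro a b j k ha hb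
    change ρ.Perceived D O (ρ.traceAt D O e.1) a.1.1 b.1.1 ↔ _
    rw [traceAt_eq hev]
    exact perceived_iff h.trace_nodup ha hb

theorem abstractExecution_RVal (hρ : ρ.IsStable D O lvlmap) (hO : O.Implements D) :
    (abstractExecution hρ).RVal Level.strong D := by
  intro e hl
  obtain ⟨r, hr, hs⟩ := exists_tobCast_of_strong hl
  refine rval_eq (exists_answered_strong hρ hr hs) fun k z hk => ?_
  obtain ⟨-, α, hα, hp, rfl⟩ := answered_strong hρ hO hr hs hk
  rw [hr.op_lvl.1]
  have hsort : α.Pairwise (fun x y => x.lvl = Level.strong ∨ y.lvl = Level.strong →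
      ρ.firstDelivery x < ρ.firstDelivery y) := by
    refine List.Pairwise.imp ?_ hp.sorted
    exact fun h _ => h
  refine (F_eq_F_traceContext hρ _ hα hsort
    (fun x hx => ((hp.mem_iff x).1 hx).1) _ Subtype.val
    Subtype.val_injective ?_ (fun _ => rfl) (fun _ _ => Iff.rfl) ?_).symm
  · intro a x hx
    refine Iff.trans ?_ (mem_range_val_sees a e).symm
    rw [hp.mem_iff, sees_strong hl, hx.arKey_eq, hr.arKey_eq]
    exact ⟨fun h => h.2, fun h => ⟨⟨_, hx⟩, h⟩⟩
  · intro a b i j ha hb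
    change ρ.arKey D O a.1.1 < ρ.arKey D O b.1.1 ↔ _
    rw [ha.arKey_eq, hb.arKey_eq]
    have hlt := List.pairwise_iff_get.1 hp.sorted
    constructor
    · intro h
      rcases lt_trichotomy i j with hij | rfl | hij
      · exact hij
      · exact absurd h (lt_irrefl _)
      · exact absurd h (hlt j i hij).asymm
    · exact fun hij => hlt i j hij

end Run

end ACT

theorem theorem3 {n : ℕ} {Op : Type u} {Val : Type v} {Client : Type x}
    (spec : ACT.Spec Op Val) (O : ACT.StateObject.{u, v, w} n Op Val)
    (hO : O.Implements spec.rdt)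
    (ρ : ACT.Run n Op Client) (hρ : ρ.IsStable spec.rdt O spec.lvlmap) :
    (ρ.history spec.rdt O).Satisfies (fun A =>
      A.FEC ACT.Level.weak spec.rdt ∧ A.Lin ACT.Level.strong spec.rdt) :=
  open ACT.Run in
  ⟨abstractExecution hρ,
    ⟨abstractExecution_EV_weak hρ, abstractExecution_NCC hρ hO _,
      abstractExecution_FRVal hρ hO, abstractExecution_CPar hρ⟩,
    abstractExecution_SinOrd hρ, abstractExecution_RT hρ hO,
    abstractExecution_EV_strong hρ, abstractExecution_NCC hρ hO _,
    abstractExecution_RVal hρ hO⟩
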